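/- All alphabets are finite and nonempty; a language over an alphabet $\Sigma$ is a subset of $\Sigma^*$. For strings $x\in\Sigma^n$, $y\in\Gamma^n$ let $\left[{x\atop y}\right]$ be the string over $\Sigma\times\Gamma$ whose $i$-th symbol is $(x_i,y_i)$. Let $\vdash,\dashv$ be two endmarkers. \textbf{$\mathrm{REG}/Rn$.} A 1dfa $M=(Q,\Delta,\delta,q_0,Q_{acc},Q_{rej})$ ($Q$ finite, $\delta:Q\times(\Delta\cup\{\vdash ,\dashv\})\to Q$, $Q_{acc}\cap Q_{rej}=\emptyset$) accepts (rejects) $w\in\Delta^*$ if after reading $\vdash w\dashv$ from left to right, starting in $q_0$, it is in a state of $Q_{acc}$ (of $Q_{rej}$). A language $L$ over $\Sigma$ is in $\mathrm{REG}/Rn$ if there are an advice alphabet $\Gamma$, a 1dfa $M$ with input alphabet $\Sigma\times\Gamma$, probability distributions $D_n$ on $\Gamma^n$ ($n\in\mathbb N$), and $\varepsilon\in[0,1/2)$ such that for all $n$ and $x\in\Sigma^n$, with $y$ drawn from $D_n$: if $x\in L$ then $M$ accepts $\left[{x\atop y}\right]$ with probability at least $1-\varepsilon$; if $x\notin L$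 then $M$ rejects $\left[{x\atop y}\right]$ with probability at least $1-\varepsilon$. \textbf{$\mathrm{1QFA}^*/Qn$.} A rewritable 1qfa with input alphabet $\Sigma$ and advice alphabet $\Gamma$ consists of a finite set $Q$ of inner states, $q_0\in Q$, disjoint $Q_{acc},Q_{rej}\subseteq Q$, unitary operators $U_{\vdash },U_{\dashv}$ on $\mathbb C^{Q}$, and, for every $\sigma\in\Sigma$, a unitary operator $U_\sigma$ on $\mathbb C^{Q\times\Gamma}$. On input $x\in\Sigma^n$ with a normalized advice state $|\phi\rangle\in\mathrm{span}\{|z\rangle: z\in\Gamma^n\}$ it starts in $|q_0\rangle|\phi\rangle$ and applies successively $V_1,\dots,V_{n+2}$, where $V_1=U_{\vdash }$ and $V_{n+2}=U_{\dashv}$ act on the inner state, and $V_{i+1}$ ($1\le i\le n$) is $U_{x_i}$ acting on the inner state and the $i$-th advice symbol (which may thus be rewritten). After each application it measures the inner state with respect to the projections $P_{acc},P_{rej},P_{non}$ onto the spans of the basis states whose inner state is in $Q_{acc}$, in $Q_{rej}$, in neither, respectively; that is, $|\psi_0\rangle=|q_0\rangle|\phi\rangle$, $|\psi_j\rangle=P_{non}V_j|\psi_{j-1}\rangle$,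 and the acceptance and rejection probabilities are $p_{acc}=\sum_{j=1}^{n+2}\|P_{acc}V_j\psi_{j-1}\|^2$ and $p_{rej}=\sum_{j=1}^{n+2}\|P_{rej}V_j\psi_{j-1}\|^2$. A language $L$ over $\Sigma$ is in $\mathrm{1QFA}^*/Qn$ if there are an advice alphabet $\Gamma$, such a machine, normalized states $|\phi_n\rangle\in\mathrm{span}\{|z\rangle: z\in\Gamma^n\}$ ($n\in\mathbb N$), and $\varepsilon\in[0,1/2)$ such that for all $n$ and $x\in\Sigma^n$, with advice $|\phi_n\rangle$: $p_{acc}\ge 1-\varepsilon$ if $x\in L$, and $p_{rej}\ge1-\varepsilon$ if $x\notin L$. \textbf{$\mathrm{1BQLIN}/Qlin$.} A one-tape quantum Turing machine (QTM) has a finite set $Q$ of inner states, an initial state $q_0$, disjoint sets $Q_{acc},Q_{rej}\subseteq Q$ whose union is the set of halting states, a finite tape alphabet $\Theta$ with a blank, a two-way infinite tape with one two-way head, and complex amplitudes $\delta(q,a;p,b,d)$ ($q,p\in Q$, $a,b\in\Theta$, $d\in\{-1,0,1\}$) of the move that, in state $q$ scanning $a$, enters $p$, writes $b$ and moves the head by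 $d$; its time-evolution operator on superpositions of configurations (with finitely many nonblank cells) must be unitary. On input $x\in\Sigma^n$ with an advice state $|\phi\rangle=\sum_{y\in\Gamma^m}\alpha_y|y\rangle$ it starts in the superposition, with amplitudes $\alpha_y$, of the initial configurations in which the string $\left[{x\atop y}\right]$ (the shorter track padded with a special symbol) is written on the otherwise blank tape and the head scans its first cell in state $q_0$; both tracks may be rewritten. A language $L$ over $\Sigma$ is in $\mathrm{1BQLIN}/Qlin$ if there are an advice alphabet $\Gamma$, a QTM, a function $\ell:\mathbb N\to\mathbb N$ with $\ell(n)=O(n)$, normalized states $|\phi_n\rangle\in\mathrm{span}\{|z\rangle: z\in\Gamma^{\ell(n)}\}$ ($n\in\mathbb N$), and a constant $k$ such that for every $n$ and $x\in\Sigma^n$ there is $t\le kn+k$ for which, with advice $|\phi_n\rangle$, all computation paths (sequences of moves of nonzero amplitude, from initial configurations of nonzero amplitude) enter a halting state for the first time after exactly $t$ steps, and observing the inner state after $t$ steps yields a state of $Q_{acc}$ with probability at least $3/4$ if $x\in L$, and a state of $Q_{rej}$ with probability at least $3/4$ if $x\notin L$. \textbf{Lemma.} $\mathrm{REG}/Rn\subseteq\mathrm{1QFA}^*/Qn\subseteq\mathrm{1BQLIN}/Qlin$.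 -/

import Mathlib

namespace Advised

/-! ### Tapes with endmarkers and one-way deterministic finite automata -/

/-- Tape symbols over `Δ`: the symbols of `Δ` together with the left and right endmarkers. -/
inductive EndSym (Δ : Type) : Type
  | left : EndSym Δ
  | sym : Δ → EndSym Δ
  | right : EndSym Δ

/-- The content of an input tape: `w`, surrounded by the two endmarkers. -/
def endmarked {Δ : Type} (w : List Δ) : List (EndSym Δ) :=
  EndSym.left :: (w.map EndSym.sym ++ [EndSym.right])

/-- One-way deterministic finite automata (1dfa's) with input alphabet `Δ` and inner states `Q`,
with accepting and rejecting states. -/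
structure OneDFA (Δ Q : Type) where
  trans : Q → EndSym Δ → Q
  start : Q
  acc : Set Q
  rej : Set Q
  disj : Disjoint acc rej

namespace OneDFA
variable {Δ Q : Type}

/-- The inner state after scanning the whole tape, including both endmarkers. -/
def final (M : OneDFA Δ Q) (w : List Δ) : Q := (endmarked w).foldl M.trans M.start

def Accepts (M : OneDFA Δ Q) (w : List Δ) : Prop := M.final w ∈ M.acc

def Rejects (M : OneDFA Δ Q) (w : List Δ) : Prop := M.final w ∈ M.rej

end OneDFA

/-- The two-track string with upper track `x` and lower track `y`, of the same length. -/
def track {α Γ : Type} {n : ℕ} (x : Fin n → α) (y : Fin n → Γ) : List (α × Γ) :=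
  List.ofFn fun i => (x i, y i)

/-- `D` is a probability ensemble: each `D n` is a probability distribution on `Γ ^ n`. -/
def IsProbEnsemble {Γ : Type} [Fintype Γ] (D : (n : ℕ) → (Fin n → Γ) → ℝ) : Prop :=
  ∀ n, (∀ y, 0 ≤ D n y) ∧ ∑ y, D n y = 1

open Classical in
/-- The probability of the event `E` under the distribution `D` on a finite set. -/
noncomputable def prob {Y : Type} [Fintype Y] (D : Y → ℝ) (E : Y → Prop) : ℝ :=
  ∑ y, if E y then D y else 0

/-- The advised family `REG/Rn`, restricted to languages over `α`: languages recognized with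
bounded error by 1dfa's with randomized advice of input size. -/
def RegRn (α : Type) : Set (Language α) :=
  {L | ∃ (Γ Q : Type) (_ : Fintype Γ) (_ : Nonempty Γ) (_ : Fintype Q)
      (M : OneDFA (α × Γ) Q) (D : (n : ℕ) → (Fin n → Γ) → ℝ) (ε : ℝ),
    0 ≤ ε ∧ ε < 1 / 2 ∧ IsProbEnsemble D ∧
    ∀ (n : ℕ) (x : Fin n → α),
      (List.ofFn x ∈ L → 1 - ε ≤ prob (D n) (fun y => M.Accepts (track x y))) ∧
      (List.ofFn x ∉ L → 1 - ε ≤ prob (D n) (fun y => M.Rejects (track x y)))}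

/-! ### Quantum advice and rewritable one-way quantum finite automata -/

/-- `φ` is a series of quantum advice states, the `n`-th being a normalized vector of
`span {|z⟩ : z ∈ Γ ^ (len n)}`, given by its amplitudes. -/
def IsQuantumAdvice {Γ : Type} [Fintype Γ] (len : ℕ → ℕ)
    (φ : (n : ℕ) → (Fin (len n) → Γ) → ℂ) : Prop :=
  ∀ n, ∑ z, ‖φ n z‖ ^ 2 = 1

/-- Rewritable measure-many 1qfa's with input alphabet `α`, advice alphabet `Γ`, inner states `Q`.
On an input symbol `σ`, the unitary `cell σ` acts on the inner state and on the advice symbol in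
the scanned cell (the input symbol itself is read-only). The endmarker cells carry no advice, so
the unitaries for the endmarkers act on the inner state only. -/
structure RewritableQFA (α Γ Q : Type) [Fintype Γ] [DecidableEq Γ] [Fintype Q] [DecidableEq Q] where
  leftEnd : Matrix.unitaryGroup Q ℂ
  cell : α → Matrix.unitaryGroup (Q × Γ) ℂ
  rightEnd : Matrix.unitaryGroup Q ℂ
  start : Q
  acc : Set Q
  rej : Set Q
  disj : Disjoint acc rej

namespace RewritableQFA
variable {α Γ Q : Type} [Fintype Γ] [DecidableEq Γ] [Fintype Q] [DecidableEq Q] {n : ℕ}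

/-- Vectors of the space `span {|q⟩|y⟩ : q ∈ Q, y ∈ Γ ^ n}`, given by their coordinates. -/
abbrev Vec (Γ Q : Type) (n : ℕ) : Type := Q × (Fin n → Γ) → ℂ

/-- The operator `A`, applied to the inner state. -/
def applyInner (A : Matrix Q Q ℂ) (ψ : Vec Γ Q n) : Vec Γ Q n :=
  fun c => ∑ p, A c.1 p * ψ (p, c.2)

/-- The operator `A`, applied to the inner state and the content of the `i`-th advice cell. -/
def applyCell (A : Matrix (Q × Γ) (Q × Γ) ℂ) (i : Fin n) (ψ : Vec Γ Q n) : Vec Γ Q n :=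
  fun c => ∑ p, ∑ b, A (c.1, c.2 i) (p, b) * ψ (p, Function.update c.2 i b)

/-- The projection onto the span of the basis vectors whose inner state is in `S`. -/
noncomputable def proj (S : Set Q) (ψ : Vec Γ Q n) : Vec Γ Q n :=
  Set.indicator {c | c.1 ∈ S} ψ

noncomputable def normSq (ψ : Vec Γ Q n) : ℝ := ∑ c, ‖ψ c‖ ^ 2

/-- The non-halting inner states. -/
def non (M : RewritableQFA α Γ Q) : Set Q := (M.acc ∪ M.rej)ᶜ

/-- The unitary operators applied on input `x`, in order: left endmarker, the `n` cells, right
endmarker. -/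
def ops (M : RewritableQFA α Γ Q) (x : Fin n → α) : List (Vec Γ Q n → Vec Γ Q n) :=
  applyInner M.leftEnd.1 ::
    (List.ofFn (fun i => applyCell (M.cell (x i)).1 i) ++ [applyInner M.rightEnd.1])

/-- One step: apply `V`, then measure. The last two components accumulate the probabilities of
acceptance and of rejection; the first is the (unnormalized) non-halting part of the state. -/
noncomputable def step (M : RewritableQFA α Γ Q) (s : Vec Γ Q n × ℝ × ℝ)
    (V : Vec Γ Q n → Vec Γ Q n) : Vec Γ Q n × ℝ × ℝ :=
  (proj M.non (V s.1), s.2.1 + normSq (proj M.acc (V s.1)), s.2.2 + normSq (proj M.rej (V s.1)))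

/-- The initial vector `|q₀⟩|φ⟩`. -/
def initVec (M : RewritableQFA α Γ Q) (φ : (Fin n → Γ) → ℂ) : Vec Γ Q n :=
  fun c => if c.1 = M.start then φ c.2 else 0

noncomputable def run (M : RewritableQFA α Γ Q) (x : Fin n → α) (φ : (Fin n → Γ) → ℂ) :
    Vec Γ Q n × ℝ × ℝ :=
  (M.ops x).foldl M.step (M.initVec φ, 0, 0)

noncomputable def accProb (M : RewritableQFA α Γ Q) (x : Fin n → α) (φ : (Fin n → Γ) → ℂ) : ℝ :=
  (M.run x φ).2.1

noncomputable def rejProb (M : RewritableQFA α Γ Q) (x : Fin n → α) (φ : (Fin n → Γ) → ℂ) : ℝ :=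
  (M.run x φ).2.2

end RewritableQFA

/-- The advised family `1QFA*/Qn`, restricted to languages over `α`: languages recognized with
bounded error by rewritable 1qfa's with quantum advice of input size. -/
def QfaStarQn (α : Type) : Set (Language α) :=
  {L | ∃ (Γ Q : Type) (_ : Fintype Γ) (_ : DecidableEq Γ) (_ : Nonempty Γ)
      (_ : Fintype Q) (_ : DecidableEq Q)
      (M : RewritableQFA α Γ Q) (φ : (n : ℕ) → (Fin n → Γ) → ℂ) (ε : ℝ),
    0 ≤ ε ∧ ε < 1 / 2 ∧ IsQuantumAdvice (fun n => n) φ ∧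
    ∀ (n : ℕ) (x : Fin n → α),
      (List.ofFn x ∈ L → 1 - ε ≤ M.accProb x (φ n)) ∧
      (List.ofFn x ∉ L → 1 - ε ≤ M.rejProb x (φ n))}

/-! ### One-tape quantum Turing machines -/

/-- One-tape one-head two-way quantum Turing machines with input alphabet `Δ`, tape alphabet `Θ`,
inner states `Q`. `δ q a p b d` is the amplitude of the move from state `q` scanning `a` to state
`p`, writing `b` and moving the head by `d ∈ {-1, 0, 1}` (left, no move, right). -/
structure QTM (Δ Θ Q : Type) where
  blank : Θ
  inp : Δ → Θ
  inp_injective : Function.Injective inp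
  inp_ne_blank : ∀ a, inp a ≠ blank
  δ : Q → Θ → Q → Θ → SignType → ℂ
  start : Q
  acc : Set Q
  rej : Set Q
  disj : Disjoint acc rej

namespace QTM
variable {Δ Θ Q : Type}

/-- Contents of a two-way infinite tape: all but finitely many cells are blank. -/
def Tape (M : QTM Δ Θ Q) : Type := {t : ℤ → Θ // {i | t i ≠ M.blank}.Finite}

/-- Writing the symbol `b` into the cell `i`. -/
def write (M : QTM Δ Θ Q) (t : M.Tape) (i : ℤ) (b : Θ) : M.Tape :=
  ⟨Function.update t.1 i b, (t.2.insert i).subset fun j hj => by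
    by_cases h : j = i
    · exact Or.inl h
    · right
      simpa [Function.update_of_ne h] using hj⟩

@[ext]
structure Config (M : QTM Δ Θ Q) where
  state : Q
  head : ℤ
  tape : M.Tape

/-- The configuration that results from `c` by the move `(p, b, d)`. -/
def move (M : QTM Δ Θ Q) (c : M.Config) (p : Q) (b : Θ) (d : SignType) : M.Config :=
  ⟨p, c.head + (d : ℤ), M.write c.tape c.head b⟩

/-- The amplitude of the move `(p, b, d)` in the configuration `c`. -/
def amp (M : QTM Δ Θ Q) (c : M.Config) (p : Q) (b : Θ) (d : SignType) : ℂ :=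
  M.δ c.state (c.tape.1 c.head) p b d

/-- The time-evolution operator, on the space of finite superpositions of configurations. -/
noncomputable def evol [Fintype Θ] [Fintype Q] (M : QTM Δ Θ Q) :
    (M.Config →₀ ℂ) →ₗ[ℂ] (M.Config →₀ ℂ) :=
  Finsupp.linearCombination ℂ fun c =>
    ∑ p : Q, ∑ b : Θ, ∑ d : SignType, Finsupp.single (M.move c p b d) (M.amp c p b d)

/-- The squared norm of a superposition. -/
noncomputable def normSq {C : Type} (ψ : C →₀ ℂ) : ℝ := ψ.sum fun _ z => ‖z‖ ^ 2

/-- Well-formedness: the time-evolution operator is unitary, that is, a bijective linear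
isometry. -/
def WellFormed [Fintype Θ] [Fintype Q] (M : QTM Δ Θ Q) : Prop :=
  Function.Bijective M.evol ∧ ∀ ψ, normSq (M.evol ψ) = normSq ψ

/-- The initial configuration on the string `w`: it is written into the cells `0, 1, …, |w| - 1`,
all other cells are blank, and the head scans the cell `0`. -/
def init (M : QTM Δ Θ Q) (w : List Δ) : M.Config where
  state := M.start
  head := 0
  tape := ⟨fun i => if h : 0 ≤ i ∧ i < w.length then M.inp (w[i.toNat]'(by omega)) else M.blank,
    (Set.finite_Ico (0 : ℤ) w.length).subset fun i hi => by
      by_contra h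
      exact hi (dif_neg h)⟩

def Halting (M : QTM Δ Θ Q) (c : M.Config) : Prop := c.state ∈ M.acc ∪ M.rej

/-- `c'` is a possible successor of `c`: some move of nonzero amplitude leads from `c` to `c'`. -/
def Succ (M : QTM Δ Θ Q) (c c' : M.Config) : Prop :=
  ∃ p b d, M.amp c p b d ≠ 0 ∧ c' = M.move c p b d

/-- Every (classically viewed) computation path from `c` reaches a halting configuration for the
first time after exactly `t` steps. -/
def HaltsAt (M : QTM Δ Θ Q) : ℕ → M.Config → Prop
  | 0, c => M.Halting c
  | t + 1, c => ¬ M.Halting c ∧ ∀ c', M.Succ c c' → M.HaltsAt t c'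

/-- The probability of observing an inner state of `S` in the superposition `ψ`. -/
noncomputable def probIn (M : QTM Δ Θ Q) (S : Set Q) (ψ : M.Config →₀ ℂ) : ℝ :=
  ψ.sum fun c z => Set.indicator {c : M.Config | c.state ∈ S} (fun _ => ‖z‖ ^ 2) c

end QTM

/-- The two-track string with upper track `x` and lower track `y` of possibly different lengths;
the end of the shorter track is padded with `none`. -/
def padTrack {α Γ : Type} {n m : ℕ} (x : Fin n → α) (y : Fin m → Γ) :
    List (Option α × Option Γ) :=
  List.zipWithAll Prod.mk (List.ofFn x) (List.ofFn y)

namespace QTM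
variable {α Γ Θ Q : Type}

/-- The initial superposition on input `x` with advice state `φ`. -/
noncomputable def initVec [Fintype Γ] (M : QTM (Option α × Option Γ) Θ Q) {n m : ℕ}
    (x : Fin n → α) (φ : (Fin m → Γ) → ℂ) : M.Config →₀ ℂ :=
  ∑ y, Finsupp.single (M.init (padTrack x y)) (φ y)

/-- The superposition after `t` steps on input `x` with advice state `φ`. -/
noncomputable def after [Fintype Γ] [Fintype Θ] [Fintype Q] (M : QTM (Option α × Option Γ) Θ Q)
    {n m : ℕ} (t : ℕ) (x : Fin n → α) (φ : (Fin m → Γ) → ℂ) : M.Config →₀ ℂ :=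
  M.evol^[t] (M.initVec x φ)

end QTM

/-- The advised family `1BQLIN/Qlin`, restricted to languages over `α`: languages recognized with
error probability at most `1/4` by one-tape quantum Turing machines with quantum advice of linear
size, such that on each input all computation paths terminate simultaneously, within a linear
number of steps. -/
def BqlinQlin (α : Type) : Set (Language α) :=
  {L | ∃ (Γ Θ Q : Type) (_ : Fintype Γ) (_ : Nonempty Γ) (_ : Fintype Θ) (_ : Fintype Q)
      (M : QTM (Option α × Option Γ) Θ Q) (len : ℕ → ℕ)
      (φ : (n : ℕ) → (Fin (len n) → Γ) → ℂ) (k : ℕ),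
    M.WellFormed ∧ IsQuantumAdvice len φ ∧ (∀ n, len n ≤ k * n + k) ∧
    ∀ (n : ℕ) (x : Fin n → α), ∃ t ≤ k * n + k,
      (∀ y, φ n y ≠ 0 → M.HaltsAt t (M.init (padTrack x y))) ∧
      (List.ofFn x ∈ L → 3 / 4 ≤ M.probIn M.acc (M.after t x (φ n))) ∧
      (List.ofFn x ∉ L → 3 / 4 ≤ M.probIn M.rej (M.after t x (φ n)))}

end Advised

/-! First inclusion. A distribution `D` becomes the superposition of all advice strings `y` with
amplitudes `√(D y)`. The dfa is made reversible by giving each advice cell a second component, which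
starts as the start state and receives the old inner state when the cell is scanned. A run then
permutes basis vectors. The string `y` itself is never altered, so different `y` stay orthogonal and
cannot interfere, and the final measurement reproduces the probabilities of the dfa exactly
(`OneDFA.toQFA_run`).

Second inclusion. A quantum Turing machine is observed only once, so the intermediate measurements
are deferred: amplitude that would halt is frozen by a flag in the inner state, and the cell where
this happens is marked. The marks keep amplitude halted at different times orthogonal, so the
squared norms add up to the original probabilities (`RewritableQFA.defer_correct`). To bring an
arbitrary error below `1/2` down to `1/4`, a fixed number of copies runs in parallel on a tensor
power of the advice, with a majority vote (`RewritableQFA.power_correct`, by a Chernoff-type bound).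
The resulting unitary sweep is carried out by a machine with `n + 3` steps
(`RewritableQFA.toQTM_after`) whose head movement does not depend on the path, so all paths halt
together (`RewritableQFA.toQTM_haltsAt`). It is well-formed because the direction of a move is a
function of the entered state: one step is a unitary on the pair of state and scanned symbol,
followed by an invertible shift (`QTM.wellFormed_of_unitary`). -/

namespace Advised

/-! ### Auxiliary facts on folds and on unitary matrices -/

/-- Two folds over lists of the same length preserve a relation that each step preserves. -/
theorem foldl_ofFn_rel {A B σ τ : Type*} {n : ℕ} (F : σ → A → σ) (G : τ → B → τ)
    (f : Fin n → A) (g : Fin n → B) (R : ℕ → σ → τ → Prop) {s : σ} {t : τ} (h0 : R 0 s t)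
    (hs : ∀ (i : Fin n) (s : σ) (t : τ), R i s t → R (i + 1) (F s (f i)) (G t (g i))) :
    R n ((List.ofFn f).foldl F s) ((List.ofFn g).foldl G t) := by
  induction n generalizing s t R with
  | zero => simpa using h0
  | succ n ih =>
    rw [List.ofFn_succ, List.ofFn_succ, List.foldl_cons, List.foldl_cons]
    exact ih (fun i => f i.succ) (fun i => g i.succ) (fun i => R (i + 1))
      (hs 0 s t h0) (fun i s t h => hs i.succ s t (by simpa using h))

theorem sum_norm_sq_unitary {X : Type*} [Fintype X] [DecidableEq X]
    (U : Matrix.unitaryGroup X ℂ) (v : X → ℂ) :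
    ∑ x, ‖∑ y, U.1 x y * v y‖ ^ 2 = ∑ x, ‖v x‖ ^ 2 := by
  have key : ∀ w : X → ℂ, ((∑ x, ‖w x‖ ^ 2 : ℝ) : ℂ) = star w ⬝ᵥ w := by
    intro w
    simp [dotProduct, ← Complex.normSq_eq_norm_sq, Complex.normSq_eq_conj_mul_self]
  have h1 : (fun x => ∑ y, U.1 x y * v y) = Matrix.mulVec U.1 v := rfl
  have h2 : star U.1 * U.1 = 1 := Matrix.mem_unitaryGroup_iff'.1 U.2
  apply Complex.ofReal_injective
  rw [key v, key (fun x => ∑ y, U.1 x y * v y), h1, Matrix.star_mulVec,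
    ← Matrix.dotProduct_mulVec, Matrix.mulVec_mulVec, ← Matrix.star_eq_conjTranspose, h2,
    Matrix.one_mulVec]

/-- The unitary matrix of a permutation of the basis. -/
def permUnitary {X : Type*} [Fintype X] [DecidableEq X] (σ : Equiv.Perm X) :
    Matrix.unitaryGroup X ℂ :=
  ⟨Matrix.of fun i j => if i = σ j then 1 else 0, by
    rw [Matrix.mem_unitaryGroup_iff]
    ext i j
    rw [Matrix.mul_apply, ← Equiv.sum_comp σ.symm]
    simp [Matrix.star_apply, Matrix.one_apply]⟩

theorem permUnitary_apply {X : Type*} [Fintype X] [DecidableEq X] (σ : Equiv.Perm X) (i j : X) :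
    (permUnitary σ).1 i j = if i = σ j then 1 else 0 := rfl

theorem sum_permUnitary_mul {X : Type*} [Fintype X] [DecidableEq X] (σ : Equiv.Perm X)
    (v : X → ℂ) (i : X) : ∑ j, (permUnitary σ).1 i j * v j = v (σ.symm i) := by
  rw [← Equiv.sum_comp σ.symm]
  simp [permUnitary_apply]

/-- The unitary matrix that acts by `T k` on the summand with index `k` of a direct sum. -/
def blockUnitary {X Y K : Type*} [Fintype X] [DecidableEq X] [Fintype Y] [DecidableEq Y]
    [Fintype K] [DecidableEq K] (e : X ≃ Y × K) (T : K → Matrix.unitaryGroup Y ℂ) :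
    Matrix.unitaryGroup X ℂ :=
  ⟨(Matrix.blockDiagonal fun k => (T k).1).submatrix e e, by
    have h : ∀ k, (T k).1 * star (T k).1 = 1 := fun k => Matrix.mem_unitaryGroup_iff.1 (T k).2
    rw [Matrix.mem_unitaryGroup_iff, Matrix.star_eq_conjTranspose, Matrix.conjTranspose_submatrix,
      Matrix.submatrix_mul_equiv, Matrix.blockDiagonal_conjTranspose, ← Matrix.blockDiagonal_mul]
    simp only [← Matrix.star_eq_conjTranspose, h]
    have : (fun _ : K => (1 : Matrix Y Y ℂ)) = 1 := rfl
    rw [this, Matrix.blockDiagonal_one, Matrix.submatrix_one_equiv]⟩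

section
variable {X Y K : Type*} [Fintype X] [DecidableEq X] [Fintype Y] [DecidableEq Y]
  [Fintype K] [DecidableEq K] (e : X ≃ Y × K) (T : K → Matrix.unitaryGroup Y ℂ)

theorem blockUnitary_apply (i j : X) :
    (blockUnitary e T).1 i j = if (e i).2 = (e j).2 then (T (e i).2).1 (e i).1 (e j).1 else 0 := by
  simp [blockUnitary, Matrix.blockDiagonal_apply]

theorem sum_blockUnitary_mul (v : X → ℂ) (i : X) :
    ∑ j, (blockUnitary e T).1 i j * v j =
      ∑ y, (T (e i).2).1 (e i).1 y * v (e.symm (y, (e i).2)) := by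
  rw [← Equiv.sum_comp e.symm, Fintype.sum_prod_type]
  simp [blockUnitary_apply]

end

namespace RewritableQFA
variable {α Γ Q : Type} [Fintype Γ] [Fintype Q] {n : ℕ}

theorem applyCell_eq (A : Matrix (Q × Γ) (Q × Γ) ℂ) (i : Fin n) (ψ : Vec Γ Q n)
    (c : Q × (Fin n → Γ)) :
    applyCell A i ψ c = ∑ x : Q × Γ, A (c.1, c.2 i) x * ψ (x.1, Function.update c.2 i x.2) := by
  rw [Fintype.sum_prod_type]; rfl

variable [DecidableEq Γ] [DecidableEq Q]

theorem run_eq (M : RewritableQFA α Γ Q) (x : Fin n → α) (φ : (Fin n → Γ) → ℂ) :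
    M.run x φ = M.step ((List.ofFn fun i => applyCell (M.cell (x i)).1 i).foldl M.step
      (M.step (M.initVec φ, 0, 0) (applyInner M.leftEnd.1))) (applyInner M.rightEnd.1) := by
  simp [run, ops]

end RewritableQFA

/-- The squared norm of a combination of distinct basis vectors. -/
theorem sum_norm_sq_sum_ite {X Y : Type*} [Fintype X] [Fintype Y] [DecidableEq X]
    {f : Y → X} (hf : Function.Injective f) (a : Y → ℂ) (S : X → Prop) [DecidablePred S] :
    (∑ x, if S x then ‖∑ y, if x = f y then a y else 0‖ ^ 2 else 0) =
      ∑ y, if S (f y) then ‖a y‖ ^ 2 else 0 := by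
  classical
  have h : ∀ x, ‖∑ y, if x = f y then a y else 0‖ ^ 2 =
      ∑ y, if x = f y then ‖a y‖ ^ 2 else 0 := by
    intro x
    by_cases hx : ∃ y, x = f y
    · obtain ⟨y, rfl⟩ := hx
      simp [hf.eq_iff]
    · have hx' : ∀ y, x ≠ f y := fun y h => hx ⟨y, h⟩
      simp [hx']
  have h' : ∀ x, (if S x then ‖∑ y, if x = f y then a y else 0‖ ^ 2 else 0) =
      ∑ y, if x = f y then (if S (f y) then ‖a y‖ ^ 2 else 0) else 0 := by
    intro x
    rw [h]
    split_ifs with hx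
    · refine Finset.sum_congr rfl fun y _ => ?_
      split_ifs with h1 h2 <;> simp_all
    · refine (Finset.sum_eq_zero fun y _ => ?_).symm
      split_ifs with h1 h2 <;> simp_all
  simp_rw [h']
  rw [Finset.sum_comm]
  exact Finset.sum_congr rfl fun y _ => by simp

namespace RewritableQFA
variable {α Γ Q : Type} {n : ℕ}

open Classical in
theorem normSq_proj [Fintype Γ] [Fintype Q] (S : Set Q) (ψ : Vec Γ Q n) :
    normSq (proj S ψ) = ∑ c, if c.1 ∈ S then ‖ψ c‖ ^ 2 else 0 := by
  refine Finset.sum_congr rfl fun c _ => ?_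
  by_cases h : c.1 ∈ S <;> simp [proj, Set.indicator, h]

/-- The permutation of the basis induced by a permutation of the pairs of an inner state and a
symbol in the `i`-th cell. -/
def cellPerm (σ : Equiv.Perm (Q × Γ)) (i : Fin n) : Equiv.Perm (Q × (Fin n → Γ)) where
  toFun c := ((σ (c.1, c.2 i)).1, Function.update c.2 i (σ (c.1, c.2 i)).2)
  invFun c := ((σ.symm (c.1, c.2 i)).1, Function.update c.2 i (σ.symm (c.1, c.2 i)).2)
  left_inv c := by simp
  right_inv c := by simp

variable [Fintype Q] [DecidableEq Q]

theorem applyInner_permUnitary (σ : Equiv.Perm Q) (ψ : Vec Γ Q n) (c : Q × (Fin n → Γ)) :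
    applyInner (permUnitary σ).1 ψ c = ψ (σ.symm c.1, c.2) :=
  sum_permUnitary_mul σ (fun p => ψ (p, c.2)) c.1

variable [Fintype Γ] [DecidableEq Γ]

theorem applyCell_permUnitary (σ : Equiv.Perm (Q × Γ)) (i : Fin n) (ψ : Vec Γ Q n)
    (c : Q × (Fin n → Γ)) :
    applyCell (permUnitary σ).1 i ψ c = ψ ((cellPerm σ i).symm c) := by
  rw [applyCell_eq,
    sum_permUnitary_mul σ (fun x : Q × Γ => ψ (x.1, Function.update c.2 i x.2))]
  rfl

end RewritableQFA

/-! ### From randomized advice to quantum advice -/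

namespace OneDFA
variable {α Γ Q : Type}

/-- The fold drives the dfa on all advice strings at once, which is the form in which a
superposition evolves; evaluation at one `y` recovers a single run. -/
theorem foldl_trans_track (M : OneDFA (α × Γ) Q) {n : ℕ} (x : Fin n → α) (y : Fin n → Γ) :
    (List.ofFn (fun i : Fin n => i)).foldl
      (fun (t : (Fin n → Γ) → Q) i => fun y => M.trans (t y) (.sym (x i, y i)))
      (fun _ => M.trans M.start .left) y =
    ((track x y).map EndSym.sym).foldl M.trans (M.trans M.start .left) := by
  rw [track, List.map_ofFn]
  exact foldl_ofFn_rel (fun (t : (Fin n → Γ) → Q) i => fun y => M.trans (t y) (.sym (x i, y i)))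
    M.trans (fun i => i) _ (fun _ s t => s y = t) rfl (by rintro i s t rfl; rfl)

theorem final_track (M : OneDFA (α × Γ) Q) {n : ℕ} (x : Fin n → α) (y : Fin n → Γ) :
    M.final (track x y) = M.trans ((List.ofFn (fun i : Fin n => i)).foldl
      (fun (t : (Fin n → Γ) → Q) i => fun y => M.trans (t y) (.sym (x i, y i)))
      (fun _ => M.trans M.start .left) y) .right := by
  rw [foldl_trans_track]
  simp [final, endmarked]

variable [Fintype Γ] [DecidableEq Γ] [Fintype Q] [DecidableEq Q]

/-- The step of a dfa, made reversible: the second component of the advice cell, which initially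
holds the start state, receives the old inner state. -/
def revPerm (M : OneDFA (α × Γ) Q) (σ : α) : Equiv.Perm ((Q × Bool) × (Γ × Q)) where
  -- On a second component equal to `M.start` the swap yields the next state of the dfa; its other
  -- values only complete this to a bijection.
  toFun c := ((Equiv.swap M.start (M.trans c.1.1 (.sym (σ, c.2.1))) c.2.2, c.1.2),
    (c.2.1, c.1.1))
  invFun c := ((c.2.2, c.1.2),
    (c.2.1, Equiv.swap M.start (M.trans c.2.2 (.sym (σ, c.2.1))) c.1.1))
  left_inv c := by simp
  right_inv c := by simp

/-- The rewritable 1qfa that simulates a dfa reversibly. It halts at the right endmarker only. -/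
def toQFA (M : OneDFA (α × Γ) Q) : RewritableQFA α (Γ × Q) (Q × Bool) where
  leftEnd := 1
  cell σ := permUnitary (M.revPerm σ)
  rightEnd := permUnitary ((Equiv.refl Q).prodCongr Equiv.boolNot)
  -- The endmarker transitions need not be reversible: that of the left one is absorbed into the
  -- start state, that of the right one into the halting sets. The Boolean is raised at the right
  -- end and blocks earlier halting.
  start := (M.trans M.start .left, false)
  acc := {s | s.2 = true ∧ M.trans s.1 .right ∈ M.acc}
  rej := {s | s.2 = true ∧ M.trans s.1 .right ∈ M.rej}
  disj := by
    rw [Set.disjoint_left]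
    rintro s ⟨_, h⟩ ⟨_, h'⟩
    exact Set.disjoint_left.1 M.disj h h'

/-- The quantum advice made of a distribution. -/
noncomputable def toAdvice (M : OneDFA (α × Γ) Q) {n : ℕ} (D : (Fin n → Γ) → ℝ) :
    (Fin n → Γ × Q) → ℂ :=
  fun z => ∑ y, if z = (fun i => (y i, M.start)) then (Real.sqrt (D y) : ℂ) else 0

theorem sum_toAdvice (M : OneDFA (α × Γ) Q) {n : ℕ} (D : (Fin n → Γ) → ℝ) (hD : ∀ y, 0 ≤ D y) :
    ∑ z, ‖M.toAdvice D z‖ ^ 2 = ∑ y, D y := by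
  have hf : Function.Injective fun (y : Fin n → Γ) (i : Fin n) => (y i, M.start) := by
    intro y y' h
    funext i
    exact congrArg Prod.fst (congrFun h i)
  have := sum_norm_sq_sum_ite hf (fun y => (Real.sqrt (D y) : ℂ)) (fun _ => True)
  simp only [if_true] at this
  refine this.trans (Finset.sum_congr rfl fun y _ => ?_)
  simp [Real.sq_sqrt (hD y)]

open RewritableQFA

/-- With no amplitude on a raised Boolean, no halting state is occupied and the measurement leaves
the vector unchanged. -/
theorem toQFA_step (M : OneDFA (α × Γ) Q) {n : ℕ} (ψ : Vec (Γ × Q) (Q × Bool) n)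
    (V : Vec (Γ × Q) (Q × Bool) n → Vec (Γ × Q) (Q × Bool) n)
    (h : ∀ c, c.1.2 = true → V ψ c = 0) (s : Vec (Γ × Q) (Q × Bool) n × ℝ × ℝ)
    (hs : s = (ψ, 0, 0)) :
    M.toQFA.step s V = (V ψ, 0, 0) := by
  subst hs
  have h1 : proj M.toQFA.non (V ψ) = V ψ := by
    funext c
    by_cases hc : c.1.2 = true
    · rw [h c hc, proj, Set.indicator_apply_eq_zero]
      exact fun _ => h c hc
    · refine Set.indicator_of_mem ?_ _
      simp [RewritableQFA.non, toQFA, hc]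
  have h2 : ∀ S : Set (Q × Bool), (∀ s ∈ S, s.2 = true) → normSq (proj S (V ψ)) = 0 := by
    intro S hS
    refine Finset.sum_eq_zero fun c _ => ?_
    by_cases hc : c.1 ∈ S
    · simp [proj, Set.indicator, h c (hS _ hc)]
    · simp [proj, Set.indicator, hc]
  simp only [RewritableQFA.step, h1, h2 M.toQFA.acc (fun s hs => hs.1),
    h2 M.toQFA.rej (fun s hs => hs.1), add_zero]

theorem toQFA_run (M : OneDFA (α × Γ) Q) {n : ℕ} (x : Fin n → α) (D : (Fin n → Γ) → ℝ)
    (hD : ∀ y, 0 ≤ D y) :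
    M.toQFA.accProb x (M.toAdvice D) = prob D (fun y => M.Accepts (track x y)) ∧
    M.toQFA.rejProb x (M.toAdvice D) = prob D (fun y => M.Rejects (track x y)) := by
  -- For advice `y`, `t y` is the current dfa state and `h y` the history written so far.
  let conf (t : (Fin n → Γ) → Q) (h : (Fin n → Γ) → Fin n → Q) (b : Bool) (y : Fin n → Γ) :
    (Q × Bool) × (Fin n → Γ × Q) := ((t y, b), fun j => (y j, h y j))
  let vec (t : (Fin n → Γ) → Q) (h : (Fin n → Γ) → Fin n → Q) (b : Bool) :
    Vec (Γ × Q) (Q × Bool) n :=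
      fun c => ∑ y, if c = conf t h b y then (Real.sqrt (D y) : ℂ) else 0
  have hvec : ∀ t h c, c.1.2 = true → vec t h false c = 0 := by
    intro t h c hc
    refine Finset.sum_eq_zero fun y _ => if_neg ?_
    rintro rfl
    exact absurd hc (by simp [conf])
  have hinit : M.toQFA.step (M.toQFA.initVec (M.toAdvice D), 0, 0)
      (applyInner M.toQFA.leftEnd.1) =
      (vec (fun _ => M.trans M.start .left) (fun _ _ => M.start) false, 0, 0) := by
    have h1 : applyInner M.toQFA.leftEnd.1 (M.toQFA.initVec (M.toAdvice D)) =
        vec (fun _ => M.trans M.start .left) (fun _ _ => M.start) false := by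
      funext c
      simp only [applyInner, toQFA, OneMemClass.coe_one, Matrix.one_apply, initVec, toAdvice, vec,
        conf, ite_mul, one_mul, zero_mul, Finset.sum_ite_eq, Finset.mem_univ, if_true,
        Prod.ext_iff (x := c)]
      split_ifs with h <;> simp [h]
    rw [← h1]
    exact M.toQFA_step _ _ (by rw [h1]; exact hvec _ _) _ rfl
  -- Of the history the invariant only records that unscanned cells still hold `M.start`, which is
  -- what makes the swap act as the dfa transition.
  have hmain := foldl_ofFn_rel M.toQFA.step
    (fun (t : (Fin n → Γ) → Q) i => fun y => M.trans (t y) (.sym (x i, y i)))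
    (fun i => applyCell (M.toQFA.cell (x i)).1 i) (fun i : Fin n => i)
    (fun k s t => ∃ h : (Fin n → Γ) → Fin n → Q,
      (∀ y (j : Fin n), k ≤ j → h y j = M.start) ∧ s = (vec t h false, 0, 0))
    (s := (vec (fun _ => M.trans M.start .left) (fun _ _ => M.start) false, 0, 0))
    (t := fun _ => M.trans M.start .left) ⟨fun _ _ => M.start, fun _ _ _ => rfl, rfl⟩ (by
      rintro i s t ⟨h, hh, rfl⟩
      refine ⟨fun y => Function.update (h y) i (t y), ?_, ?_⟩
      · intro y j hj
        have hne : j ≠ i := by rintro rfl; omega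
        simpa [Function.update_of_ne hne] using hh y j (by omega)
      · have h1 : applyCell (M.toQFA.cell (x i)).1 i (vec t h false) =
            vec (fun y => M.trans (t y) (.sym (x i, y i)))
              (fun y => Function.update (h y) i (t y)) false := by
          funext c
          simp only [toQFA]
          rw [applyCell_permUnitary]
          simp only [vec]
          refine Finset.sum_congr rfl fun y _ => ?_
          have : cellPerm (M.revPerm (x i)) i (conf t h false y) =
              conf (fun y => M.trans (t y) (.sym (x i, y i)))
                (fun y => Function.update (h y) i (t y)) false y := by
            refine Prod.ext ?_ ?_
            · simp [cellPerm, revPerm, conf, hh y i le_rfl]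
            · funext j
              by_cases hj : j = i
              · subst hj; simp [cellPerm, revPerm, conf]
              · simp [cellPerm, conf, hj]
          simp only [Equiv.symm_apply_eq, this]
        rw [← h1]
        exact M.toQFA_step _ _ (by rw [h1]; exact hvec _ _) _ rfl)
  obtain ⟨h, -, hs⟩ := hmain
  set t := (List.ofFn (fun i : Fin n => i)).foldl
      (fun (t : (Fin n → Γ) → Q) i => fun y => M.trans (t y) (.sym (x i, y i)))
      (fun _ => M.trans M.start .left) with ht
  have hlast : applyInner M.toQFA.rightEnd.1 (vec t h false) = vec t h true := by
    funext c
    simp only [toQFA]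
    rw [applyInner_permUnitary]
    simp only [vec]
    refine Finset.sum_congr rfl fun y _ => ?_
    congr 1
    rcases c with ⟨⟨q, b⟩, z⟩
    cases b <;> simp [conf, Prod.ext_iff]
  -- The first advice components still spell `y`, so distinct advice strings end in distinct basis
  -- vectors.
  have hinj : Function.Injective (conf t h true) := by
    intro y y' he
    funext j
    exact congrArg Prod.fst (congrFun (congrArg Prod.snd he) j)
  have hfinal : ∀ (S : Set Q),
      normSq (proj {s : Q × Bool | s.2 = true ∧ M.trans s.1 .right ∈ S} (vec t h true)) =
        prob D (fun y => M.final (track x y) ∈ S) := by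
    classical
    intro S
    rw [normSq_proj]
    refine (@sum_norm_sq_sum_ite _ _ _ _ _ _ hinj (fun y => (Real.sqrt (D y) : ℂ))
      (fun c => c.1 ∈ {s : Q × Bool | s.2 = true ∧ M.trans s.1 .right ∈ S})
      (fun _ => Classical.propDecidable _)).trans ?_
    refine Finset.sum_congr rfl fun y _ => ?_
    have hy : M.final (track x y) = M.trans (t y) .right := M.final_track x y
    simp [conf, Real.sq_sqrt (hD y), hy]
  rw [accProb, rejProb, run_eq, hinit, hs]
  simp only [RewritableQFA.step, hlast, zero_add]
  exact ⟨hfinal M.acc, hfinal M.rej⟩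

end OneDFA

theorem regRn_subset_qfaStarQn (α : Type) : RegRn α ⊆ QfaStarQn α := by
  classical
  rintro L ⟨Γ, Q, _, ⟨γ⟩, _, M, D, ε, h0, h1, hD, h⟩
  refine ⟨Γ × Q, Q × Bool, inferInstance, inferInstance, ⟨(γ, M.start)⟩, inferInstance,
    inferInstance, M.toQFA, fun n => M.toAdvice (D n), ε, h0, h1, fun n => ?_, fun n x => ?_⟩
  · rw [M.sum_toAdvice _ (hD n).1, (hD n).2]
  · rw [(M.toQFA_run x (D n) (hD n).1).1, (M.toQFA_run x (D n) (hD n).1).2]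
    exact h n x


/-! ### Deferring the measurements of a rewritable 1qfa -/

/-- Here `μ` is a pattern of marks: either no cell is marked, or exactly the one just scanned. -/
theorem sum_ite_snd_eq {Γ B : Type*} [Fintype Γ] [Fintype B] {n : ℕ} (μ : Fin n → B)
    [DecidablePred fun w : Fin n → Γ × B => ∀ j, (w j).2 = μ j] (F : (Fin n → Γ) → ℝ) :
    (∑ w : Fin n → Γ × B, if ∀ j, (w j).2 = μ j then F (fun j => (w j).1) else 0) =
      ∑ z, F z := by
  rw [← Equiv.sum_comp (Equiv.arrowProdEquivProdArrow (Fin n) (fun _ => Γ) (fun _ => B)).symm,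
    Fintype.sum_prod_type]
  refine Finset.sum_congr rfl fun z _ => ?_
  refine (Finset.sum_eq_single μ (fun ν _ hν => if_neg fun h => hν (funext h)) (by simp)).trans ?_
  exact if_pos fun _ => rfl

namespace RewritableQFA
variable {α Γ Q : Type} {n : ℕ}

open Classical in
theorem normSq_proj_eq [Fintype Γ] [Fintype Q] (S : Set Q) (ψ : Vec Γ Q n) :
    normSq (proj S ψ) = ∑ q, if q ∈ S then ∑ z, ‖ψ (q, z)‖ ^ 2 else 0 := by
  rw [normSq_proj, Fintype.sum_prod_type]
  refine Finset.sum_congr rfl fun q _ => ?_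
  by_cases h : q ∈ S <;> simp [h]

open Classical in
/-- The advice, on unmarked cells. -/
noncomputable def deferAdvice (φ : (Fin n → Γ) → ℂ) (w : Fin n → Γ × Bool) : ℂ :=
  if ∀ j, (w j).2 = false then φ (fun j => (w j).1) else 0

theorem sum_deferAdvice [Fintype Γ] (φ : (Fin n → Γ) → ℂ) :
    ∑ w, ‖deferAdvice φ w‖ ^ 2 = ∑ z, ‖φ z‖ ^ 2 := by
  classical
  rw [← sum_ite_snd_eq (fun _ : Fin n => false) (fun z => ‖φ z‖ ^ 2)]
  refine Finset.sum_congr rfl fun w _ => ?_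
  by_cases hw : ∀ j, (w j).2 = false <;> simp [hw, deferAdvice]

variable [Fintype Γ] [DecidableEq Γ] [Fintype Q] [DecidableEq Q]

/-- The vector that results from applying all operators, without measuring. -/
noncomputable def finalVec (M : RewritableQFA α Γ Q) (x : Fin n → α) (φ : (Fin n → Γ) → ℂ) :
    Vec Γ Q n :=
  (M.ops x).foldl (fun v V => V v) (M.initVec φ)

theorem finalVec_eq (M : RewritableQFA α Γ Q) (x : Fin n → α) (φ : (Fin n → Γ) → ℂ) :
    M.finalVec x φ = applyInner M.rightEnd.1
      ((List.ofFn fun i => applyCell (M.cell (x i)).1 i).foldl (fun v V => V v)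
        (applyInner M.leftEnd.1 (M.initVec φ))) := by
  simp [finalVec, ops]

def IsHalting (M : RewritableQFA α Γ Q) (q : Q) : Prop := q ∈ M.acc ∪ M.rej

open Classical in
/-- Flips the flag in halting states. -/
noncomputable def flagPerm (M : RewritableQFA α Γ Q) : Equiv.Perm (Q × Bool) :=
  Function.Involutive.toPerm (fun c => if M.IsHalting c.1 then (c.1, !c.2) else c) (by
    intro c
    by_cases h : M.IsHalting c.1 <;> simp [h])

open Classical in
/-- In halting states, exchanges lowered flag on an unmarked cell with raised flag on a marked
cell. -/
noncomputable def markPerm (M : RewritableQFA α Γ Q) : Equiv.Perm ((Q × Bool) × (Γ × Bool)) :=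
  Function.Involutive.toPerm
    (fun c => if M.IsHalting c.1.1 ∧ c.1.2 = c.2.2 then ((c.1.1, !c.1.2), (c.2.1, !c.2.2)) else c)
    (by
      rintro ⟨⟨q, f⟩, g, m⟩
      by_cases h : M.IsHalting q ∧ f = m <;> simp [h])

open Classical in
theorem flagPerm_apply (M : RewritableQFA α Γ Q) (q : Q) (f : Bool) :
    M.flagPerm (q, f) = if M.IsHalting q then (q, !f) else (q, f) := rfl

open Classical in
theorem markPerm_apply (M : RewritableQFA α Γ Q) (q : Q) (f : Bool) (w : Γ × Bool) :
    M.markPerm ((q, f), w) =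
      if M.IsHalting q ∧ f = w.2 then ((q, !f), (w.1, !w.2)) else ((q, f), w) := rfl

/-- The 1qfa that, instead of measuring, raises a flag in the inner state, and marks the scanned
cell when it does so. -/
noncomputable def defer (M : RewritableQFA α Γ Q) : RewritableQFA α (Γ × Bool) (Q × Bool) where
  leftEnd := permUnitary M.flagPerm * blockUnitary (Equiv.refl _) (fun _ => M.leftEnd)
  cell σ := permUnitary M.markPerm *
    blockUnitary (Equiv.prodProdProdComm Q Bool Γ Bool) (fun f => if f.1 then 1 else M.cell σ)
  rightEnd := blockUnitary (Equiv.refl _) (fun f => if f then 1 else M.rightEnd)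
  start := (M.start, false)
  acc := {s | s.1 ∈ M.acc}
  rej := {s | s.1 ∈ M.rej}
  disj := by
    rw [Set.disjoint_left]
    exact fun s h h' => Set.disjoint_left.1 M.disj h h'

theorem permUnitary_mul_apply {X : Type*} [Fintype X] [DecidableEq X] (σ : Equiv.Perm X)
    (B : Matrix.unitaryGroup X ℂ) (i j : X) :
    (permUnitary σ * B).1 i j = B.1 (σ.symm i) j :=
  sum_permUnitary_mul σ (fun k => B.1 k j) i

theorem defer_leftEnd_apply (M : RewritableQFA α Γ Q) (Ψ : Vec (Γ × Bool) (Q × Bool) n) (q f w) :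
    applyInner M.defer.leftEnd.1 Ψ ((q, f), w) =
      ∑ p, M.leftEnd.1 q p * Ψ ((p, (M.flagPerm (q, f)).2), w) := by
  simp only [applyInner, defer, permUnitary_mul_apply]
  rw [sum_blockUnitary_mul (Equiv.refl (Q × Bool)) (fun _ => M.leftEnd) (fun p => Ψ (p, w))]
  have h : (M.flagPerm (q, f)).1 = q := by
    by_cases h : M.IsHalting q <;> simp [flagPerm_apply, h]
  have h' : M.flagPerm.symm = M.flagPerm := rfl
  simp [h', h]

theorem defer_rightEnd_apply (M : RewritableQFA α Γ Q) (Ψ : Vec (Γ × Bool) (Q × Bool) n) (q f w) :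
    applyInner M.defer.rightEnd.1 Ψ ((q, f), w) =
      if f then Ψ ((q, f), w) else ∑ p, M.rightEnd.1 q p * Ψ ((p, f), w) := by
  simp only [applyInner, defer]
  rw [sum_blockUnitary_mul (Equiv.refl (Q × Bool)) _ (fun p => Ψ (p, w))]
  cases f <;> simp [Matrix.one_apply]

/-- Marking is the last factor of the operator and an involution, so a coordinate is read off at its
image under `markPerm`; `f'` and `m'` are the flag and the mark found there. -/
theorem defer_cell_apply (M : RewritableQFA α Γ Q) (σ : α) (i : Fin n)
    (Ψ : Vec (Γ × Bool) (Q × Bool) n) (q : Q) (f : Bool) (w : Fin n → Γ × Bool) (f' m' : Bool)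
    (h : M.markPerm ((q, f), w i) = ((q, f'), ((w i).1, m'))) :
    applyCell (M.defer.cell σ).1 i Ψ ((q, f), w) =
      if f' then Ψ ((q, f'), Function.update w i ((w i).1, m')) else
        ∑ y : Q × Γ, (M.cell σ).1 (q, (w i).1) y *
          Ψ ((y.1, f'), Function.update w i (y.2, m')) := by
  have h' : M.markPerm.symm = M.markPerm := rfl
  rw [applyCell_eq]
  simp only [defer, permUnitary_mul_apply]
  rw [sum_blockUnitary_mul _ _ (fun x : (Q × Bool) × (Γ × Bool) =>
    Ψ (x.1, Function.update w i x.2)), h', h]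
  cases f' <;> simp [Matrix.one_apply]

/-! ### The invariant linking a measured run to its deferred version -/

open Classical in
/-- The squared norm of the part of a vector with raised flag and state in `S`. -/
noncomputable def flaggedSq (S : Set Q) (Ψ : Vec (Γ × Bool) (Q × Bool) n) : ℝ :=
  ∑ q, if q ∈ S then ∑ w, ‖Ψ ((q, true), w)‖ ^ 2 else 0

open Classical in
/-- `Ψ` is a deferred version of `s` when the cells from `k` on have not yet been scanned. -/
structure DeferRel (M : RewritableQFA α Γ Q) (k : ℕ) (s : Vec Γ Q n × ℝ × ℝ)
    (Ψ : Vec (Γ × Bool) (Q × Bool) n) : Prop where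
  unflagged : ∀ q w, Ψ ((q, false), w) =
    if ∀ j, (w j).2 = false then s.1 (q, fun j => (w j).1) else 0
  -- This separates amplitude that will halt at a later cell, and mark it, from amplitude that has
  -- already halted.
  unmarked : ∀ q w (j : Fin n), k ≤ j → (w j).2 = true → Ψ ((q, true), w) = 0
  acc : flaggedSq M.acc Ψ = s.2.1
  rej : flaggedSq M.rej Ψ = s.2.2

-- The pointwise hypothesis expresses that newly halted amplitude does not overlap the old; `μ` is
-- the mark pattern on which the new part lives.
open Classical in
theorem flaggedSq_of_eq_add (M : RewritableQFA α Γ Q) (S : Set Q) (hS : S ⊆ {q | M.IsHalting q})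
    (Ψ Ψ' : Vec (Γ × Bool) (Q × Bool) n) (v : Vec Γ Q n) (μ : Fin n → Bool)
    (h : ∀ q w, M.IsHalting q → ‖Ψ' ((q, true), w)‖ ^ 2 = ‖Ψ ((q, true), w)‖ ^ 2 +
      if ∀ j, (w j).2 = μ j then ‖v (q, fun j => (w j).1)‖ ^ 2 else 0) :
    flaggedSq S Ψ' = flaggedSq S Ψ + normSq (proj S v) := by
  rw [normSq_proj_eq, flaggedSq, flaggedSq, ← Finset.sum_add_distrib]
  refine Finset.sum_congr rfl fun q _ => ?_
  by_cases hq : q ∈ S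
  · simp only [hq, if_true, h q _ (hS hq), Finset.sum_add_distrib]
    rw [sum_ite_snd_eq μ (fun z => ‖v (q, z)‖ ^ 2)]
  · simp [hq]

/-- Amplitude halting at the left endmarker is flagged without any mark. This pattern is
unambiguous, since all later flagging marks a cell. -/
theorem deferRel_init (M : RewritableQFA α Γ Q) (φ : (Fin n → Γ) → ℂ) :
    DeferRel M 0 (M.step (M.initVec φ, 0, 0) (applyInner M.leftEnd.1))
      (applyInner M.defer.leftEnd.1 (M.defer.initVec (deferAdvice φ))) := by
  classical
  set Ψ := applyInner M.defer.leftEnd.1 (M.defer.initVec (deferAdvice φ))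
  set v := applyInner M.leftEnd.1 (M.initVec φ) with hv
  have key : ∀ q w, (∑ p, M.leftEnd.1 q p * M.defer.initVec (deferAdvice φ) ((p, false), w)) =
      if ∀ j, (w j).2 = false then v (q, fun j => (w j).1) else 0 := by
    intro q w
    simp only [hv, initVec, deferAdvice, applyInner, defer]
    split_ifs with h <;> simp
  have key' : ∀ q w, (∑ p, M.leftEnd.1 q p * M.defer.initVec (deferAdvice φ) ((p, true), w)) =
      0 := by
    intro q w
    simp [initVec, defer]
  have hT : ∀ q w, Ψ ((q, true), w) =
      if M.IsHalting q ∧ ∀ j, (w j).2 = false then v (q, fun j => (w j).1) else 0 := by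
    intro q w
    rw [show Ψ ((q, true), w) = _ from M.defer_leftEnd_apply _ q true w]
    by_cases h : M.IsHalting q
    · simp [flagPerm_apply, h, key]
    · simp [flagPerm_apply, h, key']
  have hsq : ∀ S ⊆ {q | M.IsHalting q}, flaggedSq S Ψ = 0 + normSq (proj S v) := by
    intro S hS
    rw [M.flaggedSq_of_eq_add S hS 0 Ψ v (fun _ => false)]
    · congr 1
      simp [flaggedSq]
    · intro q w hq
      rw [hT]
      by_cases hw : ∀ j, (w j).2 = false <;> simp [hq, hw]
  refine ⟨fun q w => ?_, fun q w j _ hj => ?_, hsq _ fun q h => Or.inl h,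
    hsq _ fun q h => Or.inr h⟩
  · rw [show Ψ ((q, false), w) = _ from M.defer_leftEnd_apply _ q false w]
    by_cases h : M.IsHalting q
    · have h2 : q ∉ M.non := fun h' => h' h
      simp [flagPerm_apply, h, key', step, proj, h2]
    · have h2 : q ∈ M.non := h
      simp [flagPerm_apply, h, key, step, proj, h2, v]
  · rw [hT, if_neg]
    rintro ⟨-, h⟩
    simp [h j] at hj

theorem deferRel_step (M : RewritableQFA α Γ Q) (σ : α) (i : Fin n) (s : Vec Γ Q n × ℝ × ℝ)
    (Ψ : Vec (Γ × Bool) (Q × Bool) n) (hR : DeferRel M i s Ψ) :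
    DeferRel M (i + 1) (M.step s (applyCell (M.cell σ).1 i))
      (applyCell (M.defer.cell σ).1 i Ψ) := by
  classical
  set Ψ' := applyCell (M.defer.cell σ).1 i Ψ with hΨ'
  set v := applyCell (M.cell σ).1 i s.1 with hv
  have key : ∀ q (w : Fin n → Γ × Bool) (m : Bool), (∑ y : Q × Γ, (M.cell σ).1 (q, (w i).1) y *
      Ψ ((y.1, false), Function.update w i (y.2, m))) =
      if ∀ j, (if j = i then m else (w j).2) = false then v (q, fun j => (w j).1) else 0 := by
    intro q w m
    have hm : ∀ (g : Γ) j, (Function.update w i (g, m) j).2 = if j = i then m else (w j).2 := by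
      intro g j
      by_cases hj : j = i
      · subst hj; simp
      · simp [hj]
    have hz : ∀ (g : Γ), (fun j => (Function.update w i (g, m) j).1) =
        Function.update (fun j => (w j).1) i g := by
      intro g
      funext j
      by_cases hj : j = i
      · subst hj; simp
      · simp [hj]
    simp only [hR.unflagged, hm, hz]
    split_ifs with h
    · rw [hv, applyCell_eq]
    · simp
  have hF : ∀ q w, Ψ' ((q, false), w) =
      if ∀ j, (w j).2 = false then proj M.non v (q, fun j => (w j).1) else 0 := by
    intro q w
    by_cases hq : M.IsHalting q
    · have h2 : q ∉ M.non := fun h' => h' hq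
      have hp : proj M.non v (q, fun j => (w j).1) = 0 := by simp [proj, h2]
      rw [hp, ite_self]
      -- An unflagged halting coordinate must vanish. On an unmarked cell it comes from a flagged
      -- vector with cell `i` already marked, excluded by `unmarked`; on a marked cell it comes from
      -- unflagged vectors with a mark, which are zero.
      by_cases hm : (w i).2 = false
      · rw [hΨ', M.defer_cell_apply σ i Ψ q false w true true
          (by simp [markPerm_apply, hq, hm]), if_pos rfl]
        exact hR.unmarked _ _ i le_rfl (by simp)
      · rw [hΨ', M.defer_cell_apply σ i Ψ q false w false true (by
          simp at hm
          simp [markPerm_apply, hm, Prod.ext_iff]), if_neg (by simp), key, if_neg]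
        intro h
        simpa using h i
    · have h2 : q ∈ M.non := hq
      have hp : proj M.non v (q, fun j => (w j).1) = v (q, fun j => (w j).1) := by
        simp [proj, h2]
      rw [hp, hΨ', M.defer_cell_apply σ i Ψ q false w false (w i).2
          (by simp [markPerm_apply, hq]), if_neg (by simp), key]
      refine if_congr (forall_congr' fun j => ?_) rfl rfl
      split_ifs with hj
      · rw [hj]
      · rfl
  -- Newly flagged amplitude carries exactly one mark, at `i`; amplitude flagged before is
  -- untouched.
  have hT : ∀ q w, Ψ' ((q, true), w) =
      if M.IsHalting q ∧ (w i).2 = true then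
        (if ∀ j, (w j).2 = decide (j = i) then v (q, fun j => (w j).1) else 0)
      else Ψ ((q, true), w) := by
    intro q w
    by_cases hq : M.IsHalting q ∧ (w i).2 = true
    · rw [if_pos hq, hΨ', M.defer_cell_apply σ i Ψ q true w false false
        (by simp [markPerm_apply, hq]), if_neg (by simp), key]
      refine if_congr (forall_congr' fun j => ?_) rfl rfl
      by_cases hj : j = i
      · subst hj; simp [hq.2]
      · simp [hj]
    · have hq' : ¬ (M.IsHalting q ∧ true = (w i).2) := fun h => hq ⟨h.1, h.2.symm⟩
      rw [if_neg hq, hΨ', M.defer_cell_apply σ i Ψ q true w true (w i).2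
        (by rw [markPerm_apply, if_neg hq']), if_pos rfl, Prod.mk.eta, Function.update_eq_self]
  have hsq : ∀ S ⊆ {q | M.IsHalting q}, flaggedSq S Ψ' = flaggedSq S Ψ + normSq (proj S v) := by
    intro S hS
    refine M.flaggedSq_of_eq_add S hS Ψ Ψ' v (fun j => decide (j = i)) fun q w hq => ?_
    rw [hT]
    by_cases hm : (w i).2 = true
    · rw [hR.unmarked q w i le_rfl hm]
      by_cases hw : ∀ j, (w j).2 = decide (j = i) <;> simp [hq, hm, hw]
    · have hw : ¬ ∀ j, (w j).2 = decide (j = i) := fun h => hm (by simpa using h i)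
      rw [if_neg (fun h => hm h.2), if_neg hw, add_zero]
  refine ⟨hF, fun q w j hj hwj => ?_, ?_, ?_⟩
  · rw [hT]
    have hji : j ≠ i := by rintro rfl; omega
    split_ifs with h1 h2
    · simp [hji, h2 j] at hwj
    · rfl
    · exact hR.unmarked q w j (by omega) hwj
  · rw [hsq _ fun q h => Or.inl h, hR.acc]; rfl
  · rw [hsq _ fun q h => Or.inr h, hR.rej]; rfl

/-- At the right endmarker no flag is needed: the state is observed immediately afterwards, and the
two flag values contribute orthogonal parts. -/
theorem defer_final (M : RewritableQFA α Γ Q) (S : Set Q) (k : ℕ) (s : Vec Γ Q n × ℝ × ℝ)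
    (Ψ : Vec (Γ × Bool) (Q × Bool) n) (hR : DeferRel M k s Ψ) :
    normSq (proj {c : Q × Bool | c.1 ∈ S} (applyInner M.defer.rightEnd.1 Ψ)) =
      flaggedSq S Ψ + normSq (proj S (applyInner M.rightEnd.1 s.1)) := by
  classical
  rw [normSq_proj_eq, normSq_proj_eq, flaggedSq, Fintype.sum_prod_type,
    ← Finset.sum_add_distrib]
  refine Finset.sum_congr rfl fun q _ => ?_
  rw [Fintype.sum_bool]
  by_cases hq : q ∈ S
  · simp only [Set.mem_ofPred_eq, hq, if_true, defer_rightEnd_apply, hR.unflagged]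
    congr 1
    rw [← sum_ite_snd_eq (fun _ : Fin n => false) (fun z => ‖applyInner M.rightEnd.1 s.1 (q, z)‖ ^ 2)]
    refine Finset.sum_congr rfl fun w _ => ?_
    by_cases hw : ∀ j, (w j).2 = false <;> simp [hw, applyInner]
  · simp [hq]

theorem defer_correct (M : RewritableQFA α Γ Q) (x : Fin n → α) (φ : (Fin n → Γ) → ℂ) :
    normSq (proj M.defer.acc (M.defer.finalVec x (deferAdvice φ))) = M.accProb x φ ∧
    normSq (proj M.defer.rej (M.defer.finalVec x (deferAdvice φ))) = M.rejProb x φ := by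
  have h := foldl_ofFn_rel M.step
    (fun (v : Vec (Γ × Bool) (Q × Bool) n) V => V v)
    (fun i => applyCell (M.cell (x i)).1 i) (fun i => applyCell (M.defer.cell (x i)).1 i)
    (DeferRel M) (M.deferRel_init φ) (fun i s t hR => M.deferRel_step (x i) i s t hR)
  rw [finalVec_eq, accProb, rejProb, run_eq]
  constructor
  · refine (M.defer_final M.acc n _ _ h).trans ?_
    rw [h.acc]; rfl
  · refine (M.defer_final M.rej n _ _ h).trans ?_
    rw [h.rej]; rfl

end RewritableQFA

/-! ### Amplification by independent runs in parallel -/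

/-- Markov's bound for the probability that at most half of `k` independent samples lie in an
event of probability at least `1 - ε`. -/
theorem majority_tail {X : Type*} [Fintype X] (p : X → ℝ) (hp : ∀ x, 0 ≤ p x)
    (hp1 : ∑ x, p x = 1) (A : Set X) [DecidablePred (· ∈ A)] {ε : ℝ} (h0 : 0 < ε) (h1 : ε < 1 / 2)
    (hA : 1 - ε ≤ ∑ x, if x ∈ A then p x else 0) (k : ℕ) :
    (∑ f : Fin k → X, if 2 * (Finset.univ.filter fun l => f l ∈ A).card ≤ k
      then ∏ l, p (f l) else 0) ≤ (1 / 2 + 2 * ε * (1 - ε)) ^ k := by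
  -- Exponential weights: if at most half of the samples lie in `A`, the factors `2ε` are
  -- outnumbered or matched by their inverses, so the product of weights is at least `1`. The mean
  -- weight is at most `1/2 + 2ε(1 - ε)`.
  let g : X → ℝ := fun x => if x ∈ A then 2 * ε else (2 * ε)⁻¹
  have hg : ∀ x, 0 ≤ g x := fun x => by simp only [g]; split_ifs <;> positivity
  have h2 : (1 : ℝ) ≤ (2 * ε)⁻¹ := (one_le_inv₀ (by positivity)).2 (by linarith)
  have key : ∀ f : Fin k → X, (if 2 * (Finset.univ.filter fun l => f l ∈ A).card ≤ k
      then ∏ l, p (f l) else 0) ≤ ∏ l, (p (f l) * g (f l)) := by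
    intro f
    have hpf : 0 ≤ ∏ l, p (f l) := Finset.prod_nonneg fun l _ => hp _
    rw [Finset.prod_mul_distrib]
    split_ifs with h
    · refine le_mul_of_one_le_right hpf ?_
      simp only [g]
      rw [Finset.prod_ite, Finset.prod_const, Finset.prod_const]
      have hc := Finset.card_filter_add_card_filter_not (s := (Finset.univ : Finset (Fin k)))
        (fun l => f l ∈ A)
      rw [Finset.card_univ, Fintype.card_fin] at hc
      obtain ⟨d, hd⟩ : ∃ d, (Finset.univ.filter fun l => ¬ f l ∈ A).card =
          (Finset.univ.filter fun l => f l ∈ A).card + d := Nat.exists_eq_add_of_le (by omega)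
      rw [hd, pow_add, ← mul_assoc, ← mul_pow, mul_inv_cancel₀ (by positivity), one_pow, one_mul]
      exact one_le_pow₀ h2
    · exact mul_nonneg hpf (Finset.prod_nonneg fun l _ => hg _)
  refine (Finset.sum_le_sum fun f _ => key f).trans ?_
  have hpow : ∑ f : Fin k → X, ∏ l, (p (f l) * g (f l)) = (∑ x, p x * g x) ^ k := by
    have := Finset.prod_univ_sum (fun _ : Fin k => (Finset.univ : Finset X))
      (fun _ x => p x * g x)
    rw [Fintype.piFinset_univ, Finset.prod_const, Finset.card_univ, Fintype.card_fin] at this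
    exact this.symm
  rw [hpow]
  refine pow_le_pow_left₀ (Finset.sum_nonneg fun x _ => mul_nonneg (hp x) (hg x)) ?_ k
  set a := ∑ x, if x ∈ A then p x else 0
  have hsum : ∑ x, p x * g x = (2 * ε)⁻¹ - a * ((2 * ε)⁻¹ - 2 * ε) := by
    have hx : ∀ x, p x * g x = p x * (2 * ε)⁻¹ -
        (if x ∈ A then p x else 0) * ((2 * ε)⁻¹ - 2 * ε) := by
      intro x
      simp only [g]
      split_ifs <;> ring
    simp_rw [hx]
    rw [Finset.sum_sub_distrib, ← Finset.sum_mul, ← Finset.sum_mul, hp1, one_mul]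
  rw [hsum]
  have h3 : (1 - ε) * ((2 * ε)⁻¹ - 2 * ε) ≤ a * ((2 * ε)⁻¹ - 2 * ε) :=
    mul_le_mul_of_nonneg_right hA (by linarith)
  have h4 : ε * (2 * ε)⁻¹ = 1 / 2 := by field_simp
  nlinarith

/-- The base equals `1 - (1 - 2δ)² / 2`, hence is below `1`. Raising the error to at least `1/4`
keeps it positive, as the weights `(2δ)⁻¹` require. -/
theorem exists_pow_le_quarter {ε : ℝ} (h1 : ε < 1 / 2) :
    ∃ δ, ε ≤ δ ∧ 0 < δ ∧ δ < 1 / 2 ∧ ∃ k : ℕ, (1 / 2 + 2 * δ * (1 - δ)) ^ k ≤ 1 / 4 := by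
  refine ⟨max ε (1 / 4), le_max_left _ _, lt_max_of_lt_right (by norm_num),
    max_lt h1 (by norm_num), ?_⟩
  have h2 : max ε (1 / 4) < 1 / 2 := max_lt h1 (by norm_num)
  obtain ⟨k, hk⟩ := exists_pow_lt_of_lt_one (show (0 : ℝ) < 1 / 4 by norm_num)
    (show 1 / 2 + 2 * max ε (1 / 4) * (1 - max ε (1 / 4)) < 1 by
      nlinarith [mul_pos (sub_pos.2 h2) (sub_pos.2 h2)])
  exact ⟨k, hk.le⟩

/-! ### Tensor powers of matrices, advice and automata -/

/-- The tensor power of a unitary matrix. -/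
def tensorUnitary {X : Type*} [Fintype X] [DecidableEq X] (k : ℕ) (U : Matrix.unitaryGroup X ℂ) :
    Matrix.unitaryGroup (Fin k → X) ℂ :=
  ⟨Matrix.of fun f g => ∏ l, U.1 (f l) (g l), by
    rw [Matrix.mem_unitaryGroup_iff]
    ext f g
    have h : U.1 * star U.1 = 1 := Matrix.mem_unitaryGroup_iff.1 U.2
    have h' : ∀ l, ∑ x, U.1 (f l) x * star (U.1 (g l) x) = if f l = g l then 1 else 0 := by
      intro l
      rw [← Matrix.one_apply, ← h]; rfl
    have := Finset.prod_univ_sum (fun _ : Fin k => (Finset.univ : Finset X))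
      (fun l x => U.1 (f l) x * star (U.1 (g l) x))
    rw [Fintype.piFinset_univ] at this
    simp only [h', Finset.prod_mul_distrib] at this
    simp only [Matrix.mul_apply, Matrix.star_apply, Matrix.of_apply, star_prod]
    rw [← this, Matrix.one_apply, Finset.prod_ite_zero]
    simp [funext_iff]⟩

theorem sum_tensorUnitary_mul {X : Type*} [Fintype X] [DecidableEq X] (k : ℕ)
    (U : Matrix.unitaryGroup X ℂ) (v : Fin k → X → ℂ) (f : Fin k → X) :
    ∑ g, (tensorUnitary k U).1 f g * ∏ l, v l (g l) = ∏ l, ∑ x, U.1 (f l) x * v l x := by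
  rw [Finset.prod_univ_sum, Fintype.piFinset_univ]
  refine Finset.sum_congr rfl fun g _ => ?_
  rw [Finset.prod_mul_distrib]; rfl

/-- The unitary matrix in other coordinates. -/
def reindexUnitary {X Y : Type*} [Fintype X] [DecidableEq X] [Fintype Y] [DecidableEq Y]
    (e : X ≃ Y) (U : Matrix.unitaryGroup Y ℂ) : Matrix.unitaryGroup X ℂ :=
  ⟨U.1.submatrix e e, by
    have h : U.1 * star U.1 = 1 := Matrix.mem_unitaryGroup_iff.1 U.2
    rw [Matrix.mem_unitaryGroup_iff, Matrix.star_eq_conjTranspose, Matrix.conjTranspose_submatrix,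
      Matrix.submatrix_mul_equiv, ← Matrix.star_eq_conjTranspose, h, Matrix.submatrix_one_equiv]⟩

namespace RewritableQFA
variable {α Γ Q : Type} {n : ℕ}

/-- The tensor power of a vector. -/
def powerVec (k : ℕ) (ψ : Vec Γ Q n) : Vec (Fin k → Γ) (Fin k → Q) n :=
  fun c => ∏ l, ψ (c.1 l, fun j => c.2 j l)

def powerAdvice (k : ℕ) (φ : (Fin n → Γ) → ℂ) (w : Fin n → Fin k → Γ) : ℂ :=
  ∏ l, φ (fun j => w j l)

theorem sum_powerAdvice [Fintype Γ] (k : ℕ) (φ : (Fin n → Γ) → ℂ) :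
    ∑ w, ‖powerAdvice k φ w‖ ^ 2 = (∑ z, ‖φ z‖ ^ 2) ^ k := by
  have h := Finset.prod_univ_sum (fun _ : Fin k => (Finset.univ : Finset (Fin n → Γ)))
    (fun _ z => ‖φ z‖ ^ 2)
  rw [Fintype.piFinset_univ, Finset.prod_const, Finset.card_univ, Fintype.card_fin] at h
  rw [h, ← Equiv.sum_comp (Equiv.piComm fun (_ : Fin k) (_ : Fin n) => Γ)]
  refine Finset.sum_congr rfl fun w _ => ?_
  simp [powerAdvice, Finset.prod_pow, norm_prod]

variable [Fintype Q] [DecidableEq Q]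

theorem power_applyInner (k : ℕ) (U : Matrix.unitaryGroup Q ℂ) (ψ : Vec Γ Q n) :
    applyInner (tensorUnitary k U).1 (powerVec k ψ) = powerVec k (applyInner U.1 ψ) := by
  funext c
  exact sum_tensorUnitary_mul k U (fun l p => ψ (p, fun j => c.2 j l)) c.1

theorem normSq_applyInner [Fintype Γ] (U : Matrix.unitaryGroup Q ℂ) (ψ : Vec Γ Q n) :
    normSq (applyInner U.1 ψ) = normSq ψ := by
  rw [normSq, normSq, Fintype.sum_prod_type_right, Fintype.sum_prod_type_right]
  exact Finset.sum_congr rfl fun z _ => sum_norm_sq_unitary U fun p => ψ (p, z)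

variable [Fintype Γ] [DecidableEq Γ]

open Classical in
/-- `k` copies of a 1qfa in parallel, with majority vote. -/
def power (M : RewritableQFA α Γ Q) (k : ℕ) :
    RewritableQFA α (Fin k → Γ) (Fin k → Q) where
  leftEnd := tensorUnitary k M.leftEnd
  cell σ := reindexUnitary (Equiv.arrowProdEquivProdArrow (Fin k) (fun _ => Q) (fun _ => Γ)).symm
    (tensorUnitary k (M.cell σ))
  rightEnd := tensorUnitary k M.rightEnd
  start := fun _ => M.start
  acc := {s | k < 2 * (Finset.univ.filter fun l => s l ∈ M.acc).card}
  rej := {s | k < 2 * (Finset.univ.filter fun l => s l ∈ M.acc).card}ᶜ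
  disj := disjoint_compl_right

theorem power_applyCell (k : ℕ) (M : RewritableQFA α Γ Q) (σ : α) (i : Fin n) (ψ : Vec Γ Q n) :
    applyCell ((M.power k).cell σ).1 i (powerVec k ψ) =
      powerVec k (applyCell (M.cell σ).1 i ψ) := by
  funext c
  have h := sum_tensorUnitary_mul k (M.cell σ) (fun l (x : Q × Γ) =>
    ψ (x.1, Function.update (fun j => c.2 j l) i x.2)) (fun l => (c.1 l, c.2 i l))
  simp only [powerVec, applyCell_eq]
  rw [← h, ← Equiv.sum_comp (Equiv.arrowProdEquivProdArrow (Fin k) (fun _ => Q) (fun _ => Γ))]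
  refine Finset.sum_congr rfl fun g _ => ?_
  congr 1
  refine Finset.prod_congr rfl fun l _ => ?_
  congr 2
  funext j
  by_cases hj : j = i
  · subst hj; simp [Equiv.arrowProdEquivProdArrow]
  · simp [hj]

/-- The copies never interact and no measurement intervenes, so a product vector stays a product
vector. -/
theorem power_finalVec (k : ℕ) (M : RewritableQFA α Γ Q) (x : Fin n → α)
    (φ : (Fin n → Γ) → ℂ) :
    (M.power k).finalVec x (powerAdvice k φ) = powerVec k (M.finalVec x φ) := by
  have h0 : (M.power k).initVec (powerAdvice k φ) = powerVec k (M.initVec φ) := by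
    funext c
    simp only [initVec, powerVec, powerAdvice, power, funext_iff]
    rw [Finset.prod_ite_zero]
    simp
  have h := foldl_ofFn_rel (fun (v : Vec Γ Q n) V => V v)
    (fun (v : Vec (Fin k → Γ) (Fin k → Q) n) V => V v)
    (fun i => applyCell (M.cell (x i)).1 i) (fun i => applyCell ((M.power k).cell (x i)).1 i)
    (fun _ s t => t = powerVec k s)
    (s := applyInner M.leftEnd.1 (M.initVec φ))
    (t := applyInner (M.power k).leftEnd.1 ((M.power k).initVec (powerAdvice k φ)))
    (by rw [h0]; exact power_applyInner k M.leftEnd _)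
    (by rintro i s t rfl; exact power_applyCell k M (x i) i s)
  rw [finalVec_eq, finalVec_eq, h]
  exact power_applyInner k M.rightEnd _

theorem normSq_applyCell (U : Matrix.unitaryGroup (Q × Γ) ℂ) (i : Fin n) (ψ : Vec Γ Q n) :
    normSq (applyCell U.1 i ψ) = normSq ψ := by
  -- Once the other cells are fixed, the operator is a single unitary on the inner state and cell
  -- `i`.
  let e : Q × (Fin n → Γ) ≃ (Q × Γ) × ({j // j ≠ i} → Γ) :=
    ((Equiv.refl Q).prodCongr (Equiv.funSplitAt i Γ)).trans (Equiv.prodAssoc _ _ _).symm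
  have h1 : ∀ c, (c.1, c.2 i) = (e c).1 := fun c => rfl
  have h2 : ∀ (c : Q × (Fin n → Γ)) (x : Q × Γ),
      (x.1, Function.update c.2 i x.2) = e.symm (x, (e c).2) := by
    intro c x
    rw [Equiv.eq_symm_apply]
    refine Prod.ext (Prod.ext rfl ?_) ?_
    · simp [e]
    · funext j
      simp [e, j.2]
  rw [normSq, normSq, ← Equiv.sum_comp e.symm, ← Equiv.sum_comp e.symm,
    Fintype.sum_prod_type_right, Fintype.sum_prod_type_right]
  refine Finset.sum_congr rfl fun r _ => ?_
  simp only [applyCell_eq, h1, h2, Equiv.apply_symm_apply]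
  exact sum_norm_sq_unitary U fun x => ψ (e.symm (x, r))

theorem normSq_finalVec (M : RewritableQFA α Γ Q) (x : Fin n → α) (φ : (Fin n → Γ) → ℂ) :
    normSq (M.finalVec x φ) = ∑ z, ‖φ z‖ ^ 2 := by
  have h := foldl_ofFn_rel (fun (v : Vec Γ Q n) V => V v) (fun (_ : Unit) (_ : Fin n) => ())
    (fun i => applyCell (M.cell (x i)).1 i) (fun i => i)
    (fun _ s _ => normSq s = ∑ z, ‖φ z‖ ^ 2)
    (s := applyInner M.leftEnd.1 (M.initVec φ)) (t := ())
    (by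
      rw [normSq_applyInner, normSq, Fintype.sum_prod_type_right]
      refine Finset.sum_congr rfl fun z _ => ?_
      rw [Finset.sum_eq_single M.start] <;> simp +contextual [initVec])
    (by rintro i s t hs; rw [normSq_applyCell, hs])
  rw [finalVec_eq, normSq_applyInner, h]

/-- Amplification: with advice of norm one, the power decides by majority as a single copy does,
with smaller error. -/
theorem power_correct (M : RewritableQFA α Γ Q) (x : Fin n → α) (φ : (Fin n → Γ) → ℂ)
    (hφ : ∑ z, ‖φ z‖ ^ 2 = 1) {ε : ℝ} (h0 : 0 < ε) (h1 : ε < 1 / 2) (k : ℕ)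
    (hk : (1 / 2 + 2 * ε * (1 - ε)) ^ k ≤ 1 / 4) :
    (1 - ε ≤ normSq (proj M.acc (M.finalVec x φ)) →
      3 / 4 ≤ normSq (proj (M.power k).acc ((M.power k).finalVec x (powerAdvice k φ)))) ∧
    (1 - ε ≤ normSq (proj M.rej (M.finalVec x φ)) →
      3 / 4 ≤ normSq (proj (M.power k).rej ((M.power k).finalVec x (powerAdvice k φ)))) := by
  classical
  set ψ := M.finalVec x φ with hψ
  have htot : ∑ c, ‖ψ c‖ ^ 2 = 1 := (M.normSq_finalVec x φ).trans hφ
  let e : (Fin k → Q × (Fin n → Γ)) ≃ (Fin k → Q) × (Fin n → Fin k → Γ) :=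
    (Equiv.arrowProdEquivProdArrow (Fin k) (fun _ => Q) (fun _ => Fin n → Γ)).trans
      ((Equiv.refl _).prodCongr (Equiv.piComm fun (_ : Fin k) (_ : Fin n) => Γ))
  -- Measuring the product vector amounts to drawing `k` independent samples from the distribution
  -- `‖ψ c‖ ^ 2`.
  have hpow : ∀ S : Set (Fin k → Q), normSq (proj S (powerVec k ψ)) =
      ∑ f : Fin k → Q × (Fin n → Γ), if (fun l => (f l).1) ∈ S then ∏ l, ‖ψ (f l)‖ ^ 2 else 0 := by
    intro S
    rw [normSq_proj, ← Equiv.sum_comp e]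
    refine Finset.sum_congr rfl fun f _ => ?_
    refine if_congr Iff.rfl ?_ rfl
    rw [powerVec, norm_prod, ← Finset.prod_pow]
    rfl
  have hpow1 : ∑ f : Fin k → Q × (Fin n → Γ), ∏ l, ‖ψ (f l)‖ ^ 2 = 1 := by
    have h := Finset.prod_univ_sum
      (fun _ : Fin k => (Finset.univ : Finset (Q × (Fin n → Γ)))) (fun _ c => ‖ψ c‖ ^ 2)
    rw [Fintype.piFinset_univ] at h
    rw [← h, htot, Finset.prod_const_one]
  have hle : ∀ (S : Set (Fin k → Q)) (A : Set Q), 1 - ε ≤ normSq (proj A ψ) →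
      (∀ s ∉ S, 2 * (Finset.univ.filter fun l => s l ∈ A).card ≤ k) →
      3 / 4 ≤ normSq (proj S (powerVec k ψ)) := by
    intro S A hA hS
    rw [normSq_proj] at hA
    have ht := majority_tail (fun c => ‖ψ c‖ ^ 2) (fun _ => by positivity) htot
      {c | c.1 ∈ A} h0 h1 hA k
    have hsplit : (1 : ℝ) ≤ normSq (proj S (powerVec k ψ)) +
        ∑ f : Fin k → Q × (Fin n → Γ),
          if 2 * (Finset.univ.filter fun l => f l ∈ {c : Q × (Fin n → Γ) | c.1 ∈ A}).card ≤ k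
          then ∏ l, ‖ψ (f l)‖ ^ 2 else 0 := by
      rw [hpow, ← hpow1, ← Finset.sum_add_distrib]
      refine Finset.sum_le_sum fun f _ => ?_
      have hn : 0 ≤ ∏ l, ‖ψ (f l)‖ ^ 2 := Finset.prod_nonneg fun _ _ => by positivity
      by_cases hf : (fun l => (f l).1) ∈ S
      · rw [if_pos hf]
        split_ifs <;> linarith
      · have := hS _ hf
        rw [if_neg hf, zero_add]
        rw [if_pos]
        exact this
    linarith
  rw [power_finalVec]
  refine ⟨fun h => hle _ _ h fun s hs => ?_, fun h => hle _ _ h fun s hs => ?_⟩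
  · simpa [power] using hs
  · have hs' : k < 2 * (Finset.univ.filter fun l => s l ∈ M.acc).card := by
      simpa [power] using hs
    -- A vote outside `rej` has an accepting majority; by disjointness fewer than half of the copies
    -- can then be rejecting.
    have hd : Disjoint (Finset.univ.filter fun l => s l ∈ M.acc)
        (Finset.univ.filter fun l => s l ∈ M.rej) := by
      rw [Finset.disjoint_filter]
      exact fun l _ h h' => Set.disjoint_left.1 M.disj h h'
    have := Finset.card_union_of_disjoint hd
    have h3 := Finset.card_le_univ ((Finset.univ.filter fun l => s l ∈ M.acc) ∪
      (Finset.univ.filter fun l => s l ∈ M.rej))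
    rw [Fintype.card_fin] at h3
    omega

end RewritableQFA

/-! ### Well-formedness of quantum Turing machines -/

/-- There may be infinitely many blocks; any finite `S` that carries `ψ` will do, so that one `S`
serves a vector and its image under a block operator. -/
theorem normSq_eq_sum_blocks {C : Type} {X R : Type*} [Fintype X] (e : C ≃ X × R) (S : Finset R) (ψ : C →₀ ℂ)
    (h : ∀ c, (e c).2 ∉ S → ψ c = 0) :
    QTM.normSq ψ = ∑ r ∈ S, ∑ x, ‖ψ (e.symm (x, r))‖ ^ 2 := by
  have hs : ψ.support ⊆ (Finset.univ ×ˢ S).map e.symm.toEmbedding := by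
    intro c hc
    refine Finset.mem_map.2 ⟨e c, ?_, by simp⟩
    rw [Finset.mem_product]
    refine ⟨Finset.mem_univ _, ?_⟩
    by_contra h'
    exact Finsupp.mem_support_iff.1 hc (h c h')
  rw [QTM.normSq, Finsupp.sum_of_support_subset _ hs _ (by simp), Finset.sum_map,
    Finset.sum_product_right]
  rfl

section blockMap
variable {C X R : Type*} [Fintype X] [DecidableEq X]

/-- The operator on finite superpositions that acts by the matrix `T` on the first component of
`C ≃ X × R`. -/
noncomputable def blockMap (e : C ≃ X × R) (T : Matrix X X ℂ) : (C →₀ ℂ) →ₗ[ℂ] (C →₀ ℂ) :=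
  Finsupp.linearCombination ℂ fun c => ∑ x, Finsupp.single (e.symm (x, (e c).2)) (T x (e c).1)

theorem blockMap_apply (e : C ≃ X × R) (T : Matrix X X ℂ) (ψ : C →₀ ℂ) (c : C) :
    blockMap e T ψ c = ∑ x, T (e c).1 x * ψ (e.symm (x, (e c).2)) := by
  classical
  induction ψ using Finsupp.induction_linear with
  | zero => simp
  | add f g hf hg =>
    rw [map_add, Finsupp.add_apply, hf, hg, ← Finset.sum_add_distrib]
    simp only [Finsupp.add_apply, mul_add]
  | single c' z =>
    obtain ⟨⟨a, r⟩, rfl⟩ := e.symm.surjective c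
    obtain ⟨⟨a', r'⟩, rfl⟩ := e.symm.surjective c'
    by_cases h : r' = r
    · subst h
      simp [blockMap, Finsupp.single_apply, mul_comm]
    · simp [blockMap, h]

theorem blockMap_blockMap (e : C ≃ X × R) (S T : Matrix X X ℂ) (ψ : C →₀ ℂ) :
    blockMap e S (blockMap e T ψ) = blockMap e (S * T) ψ := by
  ext c
  simp only [blockMap_apply, Equiv.apply_symm_apply, Matrix.mul_apply, Finset.mul_sum,
    Finset.sum_mul]
  rw [Finset.sum_comm]
  simp only [mul_assoc]

theorem blockMap_one (e : C ≃ X × R) (ψ : C →₀ ℂ) : blockMap e 1 ψ = ψ := by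
  ext c
  simp [blockMap_apply, Matrix.one_apply]

theorem blockMap_bijective (e : C ≃ X × R) (T : Matrix.unitaryGroup X ℂ) :
    Function.Bijective (blockMap e T.1) := by
  refine Function.bijective_iff_has_inverse.2 ⟨blockMap e (star T.1), fun ψ => ?_, fun ψ => ?_⟩
  · rw [blockMap_blockMap, Matrix.mem_unitaryGroup_iff'.1 T.2, blockMap_one]
  · rw [blockMap_blockMap, Matrix.mem_unitaryGroup_iff.1 T.2, blockMap_one]

theorem normSq_blockMap {C : Type} (e : C ≃ X × R) (T : Matrix.unitaryGroup X ℂ) (ψ : C →₀ ℂ) :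
    QTM.normSq (blockMap e T.1 ψ) = QTM.normSq ψ := by
  classical
  have h : ∀ c, (e c).2 ∉ ψ.support.image (fun c => (e c).2) → ψ c = 0 := by
    intro c hc
    by_contra h'
    exact hc (Finset.mem_image_of_mem _ (Finsupp.mem_support_iff.2 h'))
  rw [normSq_eq_sum_blocks e _ ψ h, normSq_eq_sum_blocks e _ (blockMap e T.1 ψ)]
  · refine Finset.sum_congr rfl fun r _ => ?_
    simp only [blockMap_apply, Equiv.apply_symm_apply]
    exact sum_norm_sq_unitary T fun x => ψ (e.symm (x, r))
  · intro c hc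
    rw [blockMap_apply]
    refine Finset.sum_eq_zero fun x _ => ?_
    rw [h _ (by simpa using hc), mul_zero]

end blockMap

namespace QTM

theorem normSq_equivMapDomain {C : Type} (e : C ≃ C) (ψ : C →₀ ℂ) :
    normSq (Finsupp.equivMapDomain e ψ) = normSq ψ := by
  rw [normSq, Finsupp.sum_equivMapDomain]; rfl

variable {Δ Θ Q : Type} (M : QTM Δ Θ Q)

theorem write_write (t : M.Tape) (i : ℤ) (a b : Θ) :
    M.write (M.write t i a) i b = M.write t i b :=
  Subtype.ext (Function.update_idem _ _ _)

theorem write_self (t : M.Tape) (i : ℤ) : M.write t i (t.1 i) = t :=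
  Subtype.ext (Function.update_eq_self _ _)

theorem write_apply_self (t : M.Tape) (i : ℤ) (a : Θ) : (M.write t i a).1 i = a :=
  Function.update_self _ _ _

/-- A configuration is determined by its inner state and the scanned symbol, together with the
head position and the rest of the tape. -/
def siteEquiv : M.Config ≃ (Q × Θ) × {r : ℤ × M.Tape // r.2.1 r.1 = M.blank} where
  toFun c := ((c.state, c.tape.1 c.head),
    ⟨(c.head, M.write c.tape c.head M.blank), M.write_apply_self _ _ _⟩)
  invFun x := ⟨x.1.1, x.2.1.1, M.write x.2.1.2 x.2.1.1 x.1.2⟩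
  left_inv c := by simp [write_write, write_self]
  right_inv := by
    rintro ⟨⟨q, a⟩, ⟨h, t⟩, ht⟩
    have hw : M.write t h M.blank = t := by
      conv_rhs => rw [← M.write_self t h]
      rw [ht]
    simp only [write_apply_self, write_write, hw]

/-- The shift of the head by a distance that depends on the inner state. -/
def shiftEquiv (dir : Q → SignType) : M.Config ≃ M.Config where
  toFun c := ⟨c.state, c.head + (dir c.state : ℤ), c.tape⟩
  invFun c := ⟨c.state, c.head - (dir c.state : ℤ), c.tape⟩
  left_inv c := by simp
  right_inv c := by simp

variable [Fintype Θ] [Fintype Q] {M} {T : Matrix (Q × Θ) (Q × Θ) ℂ} {dir : Q → SignType}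

theorem evol_single
    (hδ : ∀ q a p b d, M.δ q a p b d = if d = dir p then T (p, b) (q, a) else 0)
    (c : M.Config) (z : ℂ) :
    M.evol (Finsupp.single c z) = ∑ x : Q × Θ, Finsupp.single (M.move c x.1 x.2 (dir x.1))
      (T x (c.state, c.tape.1 c.head) * z) := by
  rw [evol, Finsupp.linearCombination_single, Fintype.sum_prod_type, Finset.smul_sum]
  refine Finset.sum_congr rfl fun p _ => ?_
  rw [Finset.smul_sum]
  refine Finset.sum_congr rfl fun b _ => ?_
  rw [Finset.sum_eq_single (dir p)]
  · rw [amp, hδ, if_pos rfl, Finsupp.smul_single, smul_eq_mul, mul_comm]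
  · intro d _ hd
    rw [amp, hδ, if_neg hd, Finsupp.single_zero]
  · simp

/-- A machine is well-formed if its moves are given by a unitary matrix and the direction of a move
depends on the entered inner state only. -/
theorem wellFormed_of_unitary [DecidableEq Θ] [DecidableEq Q]
    (T : Matrix.unitaryGroup (Q × Θ) ℂ)
    (hδ : ∀ q a p b d, M.δ q a p b d = if d = dir p then T.1 (p, b) (q, a) else 0) :
    M.WellFormed := by
  -- A step is a blockwise unitary followed by a shift of the head. The shift leaves the state alone
  -- and is determined by it, hence is invertible.
  have h : ∀ ψ, M.evol ψ =
      Finsupp.equivMapDomain (M.shiftEquiv dir) (blockMap M.siteEquiv T.1 ψ) := by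
    intro ψ
    have : M.evol = (Finsupp.domLCongr (M.shiftEquiv dir)).toLinearMap ∘ₗ
        blockMap M.siteEquiv T.1 := by
      refine Finsupp.lhom_ext fun c z => ?_
      rw [evol_single hδ, LinearMap.comp_apply, blockMap, Finsupp.linearCombination_single,
        map_smul, LinearEquiv.coe_coe, map_sum, Finset.smul_sum]
      refine Finset.sum_congr rfl fun x _ => ?_
      rw [Finsupp.domLCongr_single, Finsupp.smul_single, smul_eq_mul, mul_comm]
      congr 1
      simp [siteEquiv, shiftEquiv, move, write_write]
    rw [this]; rfl
  refine ⟨?_, fun ψ => ?_⟩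
  · have : (M.evol : (M.Config →₀ ℂ) → (M.Config →₀ ℂ)) =
        (Finsupp.domLCongr (R := ℂ) (M := ℂ) (M.shiftEquiv dir)) ∘ blockMap M.siteEquiv T.1 :=
      funext h
    rw [this]
    exact (LinearEquiv.bijective _).comp (blockMap_bijective _ T)
  · rw [h, normSq_equivMapDomain, normSq_blockMap]

end QTM

/-! ### Simulation of a rewritable 1qfa by a quantum Turing machine -/

/-- The phases of the simulation: before the first move, scanning the cell of the left endmarker,
scanning the input or the cell of the right endmarker, and halting. -/
inductive Phase : Type
  | pre | left | main | done
  deriving DecidableEq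

namespace Phase

instance : Fintype Phase where
  elems := {pre, left, main, done}
  complete p := by cases p <;> simp

/-- The next phase, depending on whether the scanned cell is blank. -/
def next : Bool → Equiv.Perm Phase
  | true =>
    { toFun := fun | pre => left | left => main | main => done | done => pre
      invFun := fun | left => pre | main => left | done => main | pre => done
      left_inv := fun p => by cases p <;> rfl
      right_inv := fun p => by cases p <;> rfl }
  | false =>
    -- On nonblank cells the simulation uses only `pre → left` and `main → main`; the remaining
    -- values complete a permutation.
    { toFun := fun | pre => left | left => done | main => main | done => pre
      invFun := fun | left => pre | done => left | main => main | pre => done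
      left_inv := fun p => by cases p <;> rfl
      right_inv := fun p => by cases p <;> rfl }

/-- The direction of the move that enters a phase. -/
def dir : Phase → SignType
  | pre => 0
  | left => -1
  | main => 1
  | done => 1

end Phase

section
variable {Γ Q : Type} [Fintype Γ] [DecidableEq Γ] [Fintype Q] [DecidableEq Q]

/-- The unitary matrix `U`, acting as the identity in the absence of a symbol. -/
def extendNone (U : Matrix.unitaryGroup (Q × Γ) ℂ) : Matrix.unitaryGroup (Q × Option Γ) ℂ :=
  ⟨Matrix.of fun
    | (q, some g), (p, some b) => U.1 (q, g) (p, b)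
    | (q, none), (p, none) => if q = p then 1 else 0
    | _, _ => 0, by
    have h : U.1 * star U.1 = 1 := Matrix.mem_unitaryGroup_iff.1 U.2
    have h' : ∀ x y, ∑ z, U.1 x z * star (U.1 y z) = if x = y then 1 else 0 := by
      intro x y
      rw [← Matrix.one_apply, ← h]; rfl
    simp only [Fintype.sum_prod_type] at h'
    rw [Matrix.mem_unitaryGroup_iff]
    ext ⟨q, g⟩ ⟨p, b⟩
    rw [Matrix.mul_apply, Fintype.sum_prod_type]
    simp only [Fintype.sum_option, Matrix.star_apply, Matrix.of_apply, Matrix.one_apply]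
    cases g <;> cases b
    · by_cases hqp : q = p
      · subst hqp; simp
      · simp [hqp]
    · simp
    · simp
    · simpa using h' (q, _) (p, _)⟩

theorem extendNone_some (U : Matrix.unitaryGroup (Q × Γ) ℂ) (q p : Q) (g b : Γ) :
    (extendNone U).1 (q, some g) (p, some b) = U.1 (q, g) (p, b) := rfl

theorem extendNone_none_some (U : Matrix.unitaryGroup (Q × Γ) ℂ) (q p : Q) (b : Γ) :
    (extendNone U).1 (q, none) (p, some b) = 0 := rfl

/-- The unitary matrix `U`, acting on the inner state. -/
def innerUnitary (B : Type) [Fintype B] [DecidableEq B] (U : Matrix.unitaryGroup Q ℂ) :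
    Matrix.unitaryGroup (Q × B) ℂ :=
  blockUnitary (Equiv.refl _) fun _ => U

theorem innerUnitary_apply (B : Type) [Fintype B] [DecidableEq B] (U : Matrix.unitaryGroup Q ℂ)
    (q p : Q) (g b : B) :
    (innerUnitary B U).1 (q, g) (p, b) = if g = b then U.1 q p else 0 :=
  blockUnitary_apply _ _ _ _

end

/-- Exchanges the content of the `i`-th cell with a further symbol. -/
def swapCell {Γ : Type} {n : ℕ} (i : Fin n) : Equiv.Perm ((Fin n → Γ) × Γ) :=
  Function.Involutive.toPerm (fun y => (Function.update y.1 i y.2, y.1 i)) fun y => by simp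

theorem swapCell_apply {Γ : Type} {n : ℕ} (i : Fin n) (y : (Fin n → Γ) × Γ) :
    swapCell i y = (Function.update y.1 i y.2, y.1 i) := rfl

theorem padTrack_eq {α Γ : Type} {n : ℕ} (x : Fin n → α) (y : Fin n → Γ) :
    padTrack x y = List.ofFn fun i => (some (x i), some (y i)) := by
  induction n with
  | zero => simp [padTrack]
  | succ n ih =>
    have := ih (fun i => x i.succ) (fun i => y i.succ)
    simp only [padTrack] at this
    simp [padTrack, List.ofFn_succ, this]

namespace RewritableQFA
variable {α Γ Q : Type} [Fintype α] [DecidableEq α] [Fintype Γ] [DecidableEq Γ] [Fintype Q]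
  [DecidableEq Q] {n : ℕ}

/-- The operator applied to the inner state and the advice track. -/
def localOp (M : RewritableQFA α Γ Q) :
    Phase → Option (Option α) → Matrix.unitaryGroup (Q × Option Γ) ℂ
  | .left, _ => innerUnitary _ M.leftEnd
  | .main, some (some σ) => extendNone (M.cell σ)
  | .main, none => innerUnitary _ M.rightEnd
  | _, _ => innerUnitary _ 1

/-- The inner state and the advice track, separated from the phase and the input track. -/
def localEquiv (α Γ Q : Type) : (Phase × Q) × (Option (Option α) × Option Γ) ≃
    (Q × Option Γ) × (Phase × Option (Option α)) where
  toFun x := ((x.1.2, x.2.2), (x.1.1, x.2.1))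
  invFun x := ((x.2.1, x.1.1), (x.2.2, x.1.2))
  left_inv _ := rfl
  right_inv _ := rfl

/-- The input track controls the phase and is never rewritten, which keeps the change of phase
reversible. -/
def phasePerm (α Γ Q : Type) : Equiv.Perm ((Phase × Q) × (Option (Option α) × Option Γ)) where
  toFun x := ((Phase.next x.2.1.isNone x.1.1, x.1.2), x.2)
  invFun x := (((Phase.next x.2.1.isNone).symm x.1.1, x.1.2), x.2)
  left_inv _ := by simp
  right_inv _ := by simp

/-- The unitary matrix that gives the moves of the simulating machine. -/
def moves (M : RewritableQFA α Γ Q) :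
    Matrix.unitaryGroup ((Phase × Q) × (Option (Option α) × Option Γ)) ℂ :=
  permUnitary (phasePerm α Γ Q) * blockUnitary (localEquiv α Γ Q) fun k => M.localOp k.1 k.2

/-- Indexing rows through `phasePerm` cancels the permutation and leaves an entry of the block
matrix. -/
theorem moves_apply (M : RewritableQFA α Γ Q) (x : (Q × Option Γ) × (Phase × Option (Option α)))
    (ph : Phase) (q : Q) (κ : Option (Option α)) (g : Option Γ) :
    M.moves.1 (phasePerm α Γ Q ((localEquiv α Γ Q).symm x)) ((ph, q), (κ, g)) =
      if x.2 = (ph, κ) then (M.localOp ph κ).1 x.1 (q, g) else 0 := by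
  rw [moves, permUnitary_mul_apply, Equiv.symm_apply_apply, blockUnitary_apply,
    Equiv.apply_symm_apply]
  by_cases h : x.2 = (ph, κ)
  · rw [if_pos h, h]
    exact if_pos rfl
  · rw [if_neg h]
    exact if_neg h

/-- The quantum Turing machine that simulates a 1qfa without measurements. It first moves to the
blank cell to the left of the input, which stands for the left endmarker, and then sweeps over the
input to the blank cell to its right. -/
noncomputable def toQTM (M : RewritableQFA α Γ Q) :
    QTM (Option α × Option Γ) (Option (Option α) × Option Γ) (Phase × Q) where
  blank := (none, none)
  inp a := (some a.1, a.2)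
  inp_injective a b h := by
    simpa [Prod.ext_iff] using h
  inp_ne_blank a h := by simp at h
  δ q a p b d := if d = p.1.dir then M.moves.1 (p, b) (q, a) else 0
  start := (.pre, M.start)
  acc := {s | s.1 = .done ∧ s.2 ∈ M.acc}
  rej := {s | s.1 = .done ∧ s.2 ∈ M.rej}
  disj := by
    rw [Set.disjoint_left]
    rintro s ⟨_, h⟩ ⟨_, h'⟩
    exact Set.disjoint_left.1 M.disj h h'

theorem toQTM_wellFormed (M : RewritableQFA α Γ Q) : M.toQTM.WellFormed :=
  QTM.wellFormed_of_unitary (dir := fun p => p.1.dir) M.moves fun _ _ _ _ _ => rfl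

theorem toQTM_evol_single (M : RewritableQFA α Γ Q) (ph : Phase) (q : Q) (h : ℤ)
    (t : M.toQTM.Tape) (κ : Option (Option α)) (g : Option Γ) (ht : t.1 h = (κ, g)) (z : ℂ) :
    M.toQTM.evol (Finsupp.single ⟨(ph, q), h, t⟩ z) = ∑ y : Q × Option Γ,
      Finsupp.single ⟨(Phase.next κ.isNone ph, y.1), h + ((Phase.next κ.isNone ph).dir : ℤ),
        M.toQTM.write t h (κ, y.2)⟩ ((M.localOp ph κ).1 y (q, g) * z) := by
  rw [QTM.evol_single (T := M.moves.1) (dir := fun p => p.1.dir) (fun _ _ _ _ _ => rfl),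
    ← Equiv.sum_comp ((localEquiv α Γ Q).symm.trans (phasePerm α Γ Q)), Fintype.sum_prod_type]
  refine Finset.sum_congr rfl fun y _ => ?_
  simp only [Equiv.trans_apply, ht, moves_apply]
  rw [Finset.sum_eq_single (ph, κ)]
  · rw [if_pos rfl]; rfl
  · intro k _ hk
    rw [if_neg hk, zero_mul, Finsupp.single_zero]
  · simp

/-- The halting condition concerns single moves of nonzero amplitude, about which the evolved
superposition says nothing once paths cancel. -/
theorem toQTM_succ (M : RewritableQFA α Γ Q) (ph : Phase) (q : Q) (h : ℤ)
    (t : M.toQTM.Tape) (κ : Option (Option α)) (g : Option Γ) (ht : t.1 h = (κ, g))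
    (c : M.toQTM.Config) (hc : M.toQTM.Succ ⟨(ph, q), h, t⟩ c) :
    ∃ y : Q × Option Γ, (M.localOp ph κ).1 y (q, g) ≠ 0 ∧
      c = ⟨(Phase.next κ.isNone ph, y.1), h + ((Phase.next κ.isNone ph).dir : ℤ),
        M.toQTM.write t h (κ, y.2)⟩ := by
  obtain ⟨p, b, d, hne, rfl⟩ := hc
  obtain ⟨x, hx⟩ := ((localEquiv α Γ Q).symm.trans (phasePerm α Γ Q)).surjective (p, b)
  have hδ : M.toQTM.δ (ph, q) (κ, g) p b d ≠ 0 := by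
    simpa only [QTM.amp, ht] using hne
  simp only [toQTM] at hδ
  rw [← hx, Equiv.trans_apply, moves_apply] at hδ
  obtain ⟨y, k⟩ := x
  by_cases hd : d = p.1.dir
  · by_cases hk : k = (ph, κ)
    · subst hk hd
      obtain ⟨rfl, rfl⟩ : p = (Phase.next κ.isNone ph, y.1) ∧ b = (κ, y.2) := by
        rw [← Prod.mk.injEq, ← hx]; rfl
      refine ⟨y, ?_, rfl⟩
      simpa using hδ
    · simp [hk] at hδ
  · simp [hd] at hδ

/-- The content of the tape on input `x` with advice `y`. -/
noncomputable def tape (M : RewritableQFA α Γ Q) (x : Fin n → α) (y : Fin n → Γ) : M.toQTM.Tape :=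
  (M.toQTM.init (padTrack x y)).tape

theorem tape_apply (M : RewritableQFA α Γ Q) (x : Fin n → α) (y : Fin n → Γ) (j : ℤ) :
    (M.tape x y).1 j = if h : 0 ≤ j ∧ j < n then
      (some (some (x ⟨j.toNat, by omega⟩)), some (y ⟨j.toNat, by omega⟩)) else (none, none) := by
  simp only [tape, QTM.init, padTrack_eq, List.length_ofFn]
  by_cases h : 0 ≤ j ∧ j < n
  · rw [dif_pos h, dif_pos h, List.getElem_ofFn]; rfl
  · rw [dif_neg h, dif_neg h]; rfl

theorem tape_cell (M : RewritableQFA α Γ Q) (x : Fin n → α) (y : Fin n → Γ) (i : Fin n) :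
    (M.tape x y).1 (i : ℕ) = (some (some (x i)), some (y i)) := by
  rw [tape_apply, dif_pos ⟨by omega, by omega⟩]; rfl

theorem tape_blank (M : RewritableQFA α Γ Q) (x : Fin n → α) (y : Fin n → Γ) (j : ℤ)
    (h : ¬ (0 ≤ j ∧ j < n)) : (M.tape x y).1 j = (none, none) := by
  rw [tape_apply, dif_neg h]

theorem write_tape (M : RewritableQFA α Γ Q) (x : Fin n → α) (y : Fin n → Γ) (i : Fin n) (g : Γ) :
    M.toQTM.write (M.tape x y) (i : ℕ) (some (some (x i)), some g) =
      M.tape x (Function.update y i g) := by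
  refine Subtype.ext (funext fun j => ?_)
  by_cases hj : j = (i : ℕ)
  · subst hj
    rw [QTM.write_apply_self, tape_cell, Function.update_self]
  · rw [QTM.write]
    simp only [Function.update_of_ne hj]
    rw [tape_apply, tape_apply]
    split_ifs with h
    · rw [Function.update_of_ne]
      intro h'
      have := congrArg Fin.val h'
      simp only at this
      omega
    · rfl

/-! ### Evolution of superpositions along the sweep -/

noncomputable def conf (M : RewritableQFA α Γ Q) (ph : Phase) (h : ℤ) (x : Fin n → α)
    (c : Q × (Fin n → Γ)) : M.toQTM.Config :=
  ⟨(ph, c.1), h, M.tape x c.2⟩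

theorem conf_injective (M : RewritableQFA α Γ Q) (ph : Phase) (h : ℤ) (x : Fin n → α) :
    Function.Injective (M.conf ph h x) := by
  rintro ⟨q, y⟩ ⟨q', y'⟩ he
  refine Prod.ext (congrArg (fun c => c.state.2) he) (funext fun i => ?_)
  have := congrArg (fun c => c.tape.1 (i : ℕ)) he
  simp only [conf, tape_cell] at this
  simpa using this

/-- The superposition of configurations that corresponds to a vector of the 1qfa. -/
noncomputable def embed (M : RewritableQFA α Γ Q) (ph : Phase) (h : ℤ) (x : Fin n → α)
    (v : Vec Γ Q n) : M.toQTM.Config →₀ ℂ :=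
  ∑ c, Finsupp.single (M.conf ph h x c) (v c)

/-- This covers all steps off the input sweep. Phase and local operator must not depend on the
advice, so that the image again has one common phase and head position. -/
theorem evol_embed_inner (M : RewritableQFA α Γ Q) (ph ph' : Phase) (h h' : ℤ) (x : Fin n → α)
    (U : Matrix.unitaryGroup Q ℂ)
    (hκ : ∀ y : Fin n → Γ, Phase.next ((M.tape x y).1 h).1.isNone ph = ph' ∧
      M.localOp ph ((M.tape x y).1 h).1 = innerUnitary _ U)
    (hh : h + (ph'.dir : ℤ) = h') (v : Vec Γ Q n) :
    M.toQTM.evol (M.embed ph h x v) = M.embed ph' h' x (applyInner U.1 v) := by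
  have h1 : ∀ c : Q × (Fin n → Γ), M.toQTM.evol (Finsupp.single (M.conf ph h x c) (v c)) =
      ∑ p, Finsupp.single (M.conf ph' h' x (p, c.2)) (U.1 p c.1 * v c) := by
    intro c
    rw [conf, M.toQTM_evol_single ph c.1 h (M.tape x c.2) ((M.tape x c.2).1 h).1
      ((M.tape x c.2).1 h).2 rfl, (hκ c.2).1, (hκ c.2).2, hh,
      Fintype.sum_prod_type]
    refine Finset.sum_congr rfl fun p _ => ?_
    rw [Finset.sum_eq_single ((M.tape x c.2).1 h).2]
    · rw [innerUnitary_apply, if_pos rfl, Prod.mk.eta, QTM.write_self]; rfl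
    · intro b _ hb
      rw [innerUnitary_apply, if_neg hb, zero_mul, Finsupp.single_zero]
    · simp
  simp only [embed, map_sum, h1, applyInner, Finsupp.single_finsetSum]
  rw [Fintype.sum_prod_type_right, Fintype.sum_prod_type_right]
  exact Finset.sum_congr rfl fun y _ => Finset.sum_comm

theorem evol_embed_cell (M : RewritableQFA α Γ Q) (i : Fin n) (x : Fin n → α) (v : Vec Γ Q n) :
    M.toQTM.evol (M.embed .main (i : ℕ) x v) =
      M.embed .main ((i : ℕ) + 1 : ℕ) x (applyCell (M.cell (x i)).1 i v) := by
  have h1 : ∀ c : Q × (Fin n → Γ), M.toQTM.evol (Finsupp.single (M.conf .main (i : ℕ) x c) (v c)) =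
      ∑ p, ∑ g, Finsupp.single (M.conf .main ((i : ℕ) + 1 : ℕ) x (p, Function.update c.2 i g))
        ((M.cell (x i)).1 (p, g) (c.1, c.2 i) * v c) := by
    intro c
    rw [conf, M.toQTM_evol_single .main c.1 _ (M.tape x c.2) _ _ (M.tape_cell x c.2 i),
      Fintype.sum_prod_type]
    refine Finset.sum_congr rfl fun p _ => ?_
    rw [Fintype.sum_option]
    simp only [localOp, extendNone_none_some, extendNone_some, zero_mul, Finsupp.single_zero,
      zero_add, write_tape]
    rfl
  simp only [embed, map_sum, h1, applyCell, Finsupp.single_finsetSum]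
  rw [Fintype.sum_prod_type, Fintype.sum_prod_type]
  simp only
  have h2 : ∀ q p : Q, (∑ y : Fin n → Γ, ∑ g, Finsupp.single
      (M.conf .main ((i : ℕ) + 1 : ℕ) x (p, Function.update y i g))
        ((M.cell (x i)).1 (p, g) (q, y i) * v (q, y))) =
      ∑ y : Fin n → Γ, ∑ b, Finsupp.single (M.conf .main ((i : ℕ) + 1 : ℕ) x (p, y))
        ((M.cell (x i)).1 (p, y i) (q, b) * v (q, Function.update y i b)) := by
    intro q p
    -- `swapCell` passes from the pair (old string, written symbol) to the pair (new string,
    -- overwritten symbol).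
    rw [← Fintype.sum_prod_type', ← Fintype.sum_prod_type', ← Equiv.sum_comp (swapCell i)]
    refine Finset.sum_congr rfl fun y _ => ?_
    simp only [swapCell_apply, Function.update_idem, Function.update_self,
      Function.update_eq_self]
  have h3 : ∀ q : Q, (∑ y : Fin n → Γ, ∑ p, ∑ g, Finsupp.single
      (M.conf .main ((i : ℕ) + 1 : ℕ) x (p, Function.update y i g))
        ((M.cell (x i)).1 (p, g) (q, y i) * v (q, y))) =
      ∑ p, ∑ y : Fin n → Γ, ∑ b, Finsupp.single (M.conf .main ((i : ℕ) + 1 : ℕ) x (p, y))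
        ((M.cell (x i)).1 (p, y i) (q, b) * v (q, Function.update y i b)) := by
    intro q
    rw [Finset.sum_comm]
    exact Finset.sum_congr rfl fun p _ => h2 q p
  simp only [h3]
  rw [Finset.sum_comm]
  exact Finset.sum_congr rfl fun p _ => Finset.sum_comm

theorem evol_embed_pre (M : RewritableQFA α Γ Q) (x : Fin n → α) (v : Vec Γ Q n) :
    M.toQTM.evol (M.embed .pre 0 x v) = M.embed .left (-1) x v := by
  rw [M.evol_embed_inner .pre .left 0 (-1) x 1 (fun y => ⟨?_, rfl⟩) (by simp [Phase.dir])]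
  · congr 1
    funext c
    simp [applyInner, Matrix.one_apply]
  · cases ((M.tape x y).1 0).1.isNone <;> rfl

theorem evol_embed_left (M : RewritableQFA α Γ Q) (x : Fin n → α) (v : Vec Γ Q n) :
    M.toQTM.evol (M.embed .left (-1) x v) =
      M.embed .main (0 : ℕ) x (applyInner M.leftEnd.1 v) :=
  M.evol_embed_inner .left .main (-1) _ x M.leftEnd
    (fun y => ⟨by rw [tape_blank _ _ _ _ (by omega)]; rfl, rfl⟩) (by simp [Phase.dir]) v

theorem evol_embed_right (M : RewritableQFA α Γ Q) (x : Fin n → α) (v : Vec Γ Q n) :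
    M.toQTM.evol (M.embed .main n x v) =
      M.embed .done (n + 1) x (applyInner M.rightEnd.1 v) :=
  M.evol_embed_inner .main .done n _ x M.rightEnd
    (fun y => by rw [tape_blank _ _ _ _ (by omega)]; exact ⟨rfl, rfl⟩) (by simp [Phase.dir]) v

/-- The `n + 3` steps are the move to cell `-1`, the two endmarkers and the `n` input cells. -/
theorem toQTM_after (M : RewritableQFA α Γ Q) (x : Fin n → α) (φ : (Fin n → Γ) → ℂ) :
    M.toQTM.after (n + 3) x φ = M.embed .done (n + 1) x (M.finalVec x φ) := by
  have h0 : M.toQTM.initVec x φ = M.embed .pre 0 x (M.initVec φ) := by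
    rw [embed, Fintype.sum_prod_type_right, QTM.initVec]
    refine Finset.sum_congr rfl fun y _ => ?_
    rw [Finset.sum_eq_single M.start]
    · simp only [initVec, if_true]; rfl
    · intro q _ hq
      simp [initVec, hq]
    · simp
  have h := foldl_ofFn_rel (fun (v : Vec Γ Q n) V => V v)
    (fun (t : M.toQTM.Config →₀ ℂ) (_ : Fin n) => M.toQTM.evol t)
    (fun i => applyCell (M.cell (x i)).1 i) (fun i => i)
    (fun k s t => t = M.embed .main (k : ℕ) x s)
    (s := applyInner M.leftEnd.1 (M.initVec φ)) rfl
    (by rintro i s t rfl; exact M.evol_embed_cell i x s)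
  rw [List.foldl_const, List.length_ofFn] at h
  rw [QTM.after, finalVec_eq, h0, Function.iterate_add_apply, ← M.evol_embed_right x, ← h,
    ← Function.iterate_succ_apply' M.toQTM.evol, ← M.evol_embed_left, ← M.evol_embed_pre,
    ← Function.iterate_succ_apply, ← Function.iterate_succ_apply]
  rw [← Function.iterate_add_apply]

theorem probIn_embed (M : RewritableQFA α Γ Q) (S : Set Q) (h : ℤ) (x : Fin n → α)
    (v : Vec Γ Q n) :
    M.toQTM.probIn {s | s.1 = .done ∧ s.2 ∈ S} (M.embed .done h x v) = normSq (proj S v) := by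
  classical
  have hv : ∀ c, M.embed .done h x v (M.conf .done h x c) = v c := by
    intro c
    simp [embed, Finsupp.finsetSum_apply, Finsupp.single_apply,
      (M.conf_injective .done h x).eq_iff]
  have hs : (M.embed .done h x v).support ⊆
      Finset.univ.map ⟨M.conf .done h x, M.conf_injective .done h x⟩ := by
    intro c hc
    by_contra hc'
    refine Finsupp.mem_support_iff.1 hc ?_
    rw [embed, Finsupp.finsetSum_apply]
    refine Finset.sum_eq_zero fun c' _ => Finsupp.single_eq_of_ne fun he => hc' ?_
    exact Finset.mem_map.2 ⟨c', Finset.mem_univ _, he.symm⟩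
  rw [QTM.probIn, Finsupp.sum_of_support_subset _ hs _ (by simp [Set.indicator]),
    Finset.sum_map, normSq_proj]
  refine Finset.sum_congr rfl fun c _ => ?_
  simp only [Function.Embedding.coeFn_mk, hv]
  by_cases hc : c.1 ∈ S <;> simp [Set.indicator, conf, hc]

/-! ### Simultaneous halting of all computation paths -/

theorem not_halting (M : RewritableQFA α Γ Q) {ph : Phase} (h : ph ≠ .done) (q : Q) (i : ℤ)
    (t : M.toQTM.Tape) : ¬ M.toQTM.Halting ⟨(ph, q), i, t⟩ := by
  rintro (h' | h') <;> exact h h'.1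

theorem succ_inner (M : RewritableQFA α Γ Q) (ph : Phase) (q : Q) (h : ℤ) (t : M.toQTM.Tape)
    (U : Matrix.unitaryGroup Q ℂ) (hU : M.localOp ph (t.1 h).1 = innerUnitary _ U)
    (c : M.toQTM.Config) (hc : M.toQTM.Succ ⟨(ph, q), h, t⟩ c) :
    ∃ p, c = ⟨(Phase.next (t.1 h).1.isNone ph, p),
      h + ((Phase.next (t.1 h).1.isNone ph).dir : ℤ), t⟩ := by
  obtain ⟨⟨p, b⟩, hne, rfl⟩ := M.toQTM_succ ph q h t _ _ rfl c hc
  rw [hU, innerUnitary_apply] at hne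
  have hb : b = (t.1 h).2 := by
    by_contra hb
    exact hne (if_neg hb)
  subst hb
  exact ⟨p, by rw [Prod.mk.eta, QTM.write_self]⟩

/-- Phase and head position depend only on the fixed input track, so every path follows the same
schedule; `m` counts the cells still to be scanned. By `hM`, whichever inner state is reached at the
end is a halting one. -/
theorem haltsAt_main (M : RewritableQFA α Γ Q) (hM : M.acc ∪ M.rej = Set.univ) (x : Fin n → α)
    (m i : ℕ) (hi : i + m = n) (q : Q) (y : Fin n → Γ) :
    M.toQTM.HaltsAt (m + 1) ⟨(.main, q), i, M.tape x y⟩ := by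
  induction m generalizing i q y with
  | zero =>
    refine ⟨M.not_halting (by simp) _ _ _, fun c hc => ?_⟩
    have hb : (M.tape x y).1 i = (none, none) := M.tape_blank x y i (by omega)
    obtain ⟨p, rfl⟩ := M.succ_inner .main q i _ M.rightEnd (by rw [hb]; rfl) c hc
    rw [hb]
    have hp : p ∈ M.acc ∪ M.rej := by rw [hM]; trivial
    exact hp.imp (fun h => ⟨rfl, h⟩) (fun h => ⟨rfl, h⟩)
  | succ m ih =>
    refine ⟨M.not_halting (by simp) _ _ _, fun c hc => ?_⟩
    obtain ⟨⟨p, b⟩, hne, rfl⟩ := M.toQTM_succ .main q i _ _ _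
      (M.tape_cell x y ⟨i, by omega⟩) c hc
    cases b with
    -- `extendNone` never mixes a symbol with its absence, so the advice track stays filled.
    | none => exact absurd (extendNone_none_some _ _ _ _) hne
    | some g =>
      have := ih (i + 1) (by omega) p (Function.update y ⟨i, by omega⟩ g)
      rw [← write_tape] at this
      simpa [Phase.dir, Phase.next] using this

theorem toQTM_haltsAt (M : RewritableQFA α Γ Q) (hM : M.acc ∪ M.rej = Set.univ) (x : Fin n → α)
    (y : Fin n → Γ) : M.toQTM.HaltsAt (n + 3) (M.toQTM.init (padTrack x y)) := by
  change M.toQTM.HaltsAt (n + 3) ⟨(.pre, M.start), 0, M.tape x y⟩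
  refine ⟨M.not_halting (by simp) _ _ _, fun c hc => ?_⟩
  obtain ⟨p, rfl⟩ := M.succ_inner .pre _ 0 _ 1 rfl c hc
  have hn : Phase.next ((M.tape x y).1 0).1.isNone .pre = .left := by
    cases ((M.tape x y).1 0).1.isNone <;> rfl
  rw [hn]
  refine ⟨M.not_halting (by simp) _ _ _, fun c hc => ?_⟩
  have hb : (M.tape x y).1 (0 + ((Phase.left).dir : ℤ)) = (none, none) :=
    M.tape_blank x y _ (by simp [Phase.dir])
  obtain ⟨p, rfl⟩ := M.succ_inner .left p _ _ M.leftEnd rfl c hc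
  rw [hb]
  exact M.haltsAt_main hM x n 0 (by omega) p y

end RewritableQFA

theorem qfaStarQn_subset_bqlinQlin (α : Type) [Fintype α] : QfaStarQn α ⊆ BqlinQlin α := by
  classical
  rintro L ⟨Γ, Q, _, _, ⟨γ⟩, _, _, M, φ, ε, -, h1, hφ, h⟩
  obtain ⟨δ, hεδ, hδ0, hδ1, k, hk⟩ := exists_pow_le_quarter h1
  have hadv : ∀ n, ∑ w, ‖RewritableQFA.deferAdvice (φ n) w‖ ^ 2 = 1 := fun n =>
    (RewritableQFA.sum_deferAdvice (φ n)).trans (hφ n)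
  -- The constant `3` bounds both the advice length `n` and the running time `n + 3` by `3 * n + 3`.
  refine ⟨Fin k → Γ × Bool, _, _, inferInstance, ⟨fun _ => (γ, false)⟩, inferInstance,
    inferInstance, (M.defer.power k).toQTM, fun n => n,
    fun n => RewritableQFA.powerAdvice k (RewritableQFA.deferAdvice (φ n)), 3,
    RewritableQFA.toQTM_wellFormed _, fun n => ?_,
    fun n => show n ≤ 3 * n + 3 by omega,
    fun n x => ⟨n + 3, by omega, fun y _ => RewritableQFA.toQTM_haltsAt _ ?_ x y, ?_⟩⟩
  · rw [RewritableQFA.sum_powerAdvice, hadv, one_pow]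
  -- In the majority machine the rejecting set is the complement of the accepting one, so every
  -- final state halts.
  · exact Set.union_compl_self _
  · have hc := M.defer.power_correct x _ (hadv n) hδ0 hδ1 k hk
    rw [(M.defer_correct x (φ n)).1, (M.defer_correct x (φ n)).2] at hc
    rw [RewritableQFA.toQTM_after]
    refine ⟨fun hx => ?_, fun hx => ?_⟩
    · exact (hc.1 (by linarith [(h n x).1 hx])).trans_eq (RewritableQFA.probIn_embed _ _ _ _ _).symm
    · exact (hc.2 (by linarith [(h n x).2 hx])).trans_eq (RewritableQFA.probIn_embed _ _ _ _ _).symm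

end Advised

theorem mainTheorem10 (α : Type) [Fintype α] :
    Advised.RegRn α ⊆ Advised.QfaStarQn α ∧ Advised.QfaStarQn α ⊆ Advised.BqlinQlin α :=
  ⟨Advised.regRn_subset_qfaStarQn α, Advised.qfaStarQn_subset_bqlinQlin α⟩
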